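/- Let $d\ge 3$ be odd and let $\mathcal M_d$ denote the complex $d\times d$ matrices. A linear map $T:\mathcal M_d\to\mathcal M_d$ is a mixture of unitary channels if $T(\rho)=\sum_{i=1}^N p_i U_i\rho U_i^\dagger$ with $p_i>0$, $\sum_i p_i=1$ and $U_i$ unitary; it is $O(d)$-covariant if $T(O\rho O^{T})=O\,T(\rho)\,O^{T}$ for all real orthogonal $O$ and all $\rho$. Put $|\Omega\rangle=d^{-1/2}\sum_{j}|j,j\rangle$, $\rho_T=(\mathrm{id}\otimes T)(|\Omega\rangle\langle\Omega|)$, let $\mathbb F:|k,l\rangle\mapsto|l,k\rangle$ be the flip and $\widehat{\mathbb F}=d\,|\Omega\rangle\langle\Omega|$, and define the coordinates $$c(T)=\big(\langle\mathbb F\rangle_T,\langle\widehat{\mathbb F}\rangle_T\big)=\big(\mathrm{Re}\,\mathrm{tr}[\rho_T\mathbb F],\ \mathrm{Re}\,\mathrm{tr}[\rho_T\widehat{\mathbb F}]\big)$$ (the traces are themselves real for channels). Let $$m(x)=\Big[\tfrac12\big(1-\tfrac1d\big)\big(1-\tfrac2d+x\big)\Big]^{1/2}+\tfrac1d .$$ **Theorem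 (Odd dimension).** An $O(d)$-covariant mixture $T$ of unitary channels is determined by $c(T)$. The set of coordinates of all $O(d)$-covariant mixtures of unitary channels coincides with the set of coordinates of all mixtures of unitary channels, and with the convex hull of the coordinates of the unitary channels $\rho\mapsto U\rho U^\dagger$, $U\in U(d)$. The extreme points of this set are exactly $$\big(-1+\tfrac2d,\,0\big),\qquad (1,0)\qquad\text{and}\qquad \big(x,\ d\,m(x)^2\big),\quad x\in\big[-1+\tfrac2d,\,1\big].$$ In particular, no linear map $T$ on $\mathcal M_d$ with $\langle\mathbb F\rangle_T<-1+\frac2d$ is a mixture of unitary channels. For the Werner–Holevo-type maps $T_\delta(\rho)=\frac{1+\delta}{d}\,\mathrm{tr}[\rho]\,\mathbb 1-\delta\,\rho^{T}$, $\delta\in\mathbb R$, one has $\langle\mathbb F\rangle_{T_\delta}<-1+\frac2d$ if and only if $\delta>\frac1{d+1}$, so that $T_\delta$ is not a mixture of unitary channels for $\delta>\frac1{d+1}$. -/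

import Mathlib

open Matrix

namespace Birkhoff

noncomputable section

/-- The `d × d` complex matrices. -/
abbrev Mat (d : ℕ) : Type := Matrix (Fin d) (Fin d) ℂ

/-- Matrices on the tensor product of two copies of `ℂ^d`. -/
abbrev BiMat (d : ℕ) : Type := Matrix (Fin d × Fin d) (Fin d × Fin d) ℂ

/-- The maximally entangled vector `Ω = d^(-1/2) ∑ j, |j,j⟩`. -/
def omegaVec (d : ℕ) : Fin d × Fin d → ℂ :=
  fun p => if p.1 = p.2 then ((1 / Real.sqrt d : ℝ) : ℂ) else 0

/-- The projector `|Ω⟩⟨Ω|`. -/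
def omegaProj (d : ℕ) : BiMat d :=
  vecMulVec (omegaVec d) (star (omegaVec d))

/-- The map `id ⊗ T` on bipartite matrices: `T` is applied to each `d × d` block. -/
def idTensor {d : ℕ} (T : Mat d →ₗ[ℂ] Mat d) (X : BiMat d) : BiMat d :=
  Matrix.of fun p q => T (Matrix.of fun a b => X (p.1, a) (q.1, b)) p.2 q.2

/-- The Jamiolkowski operator `ρ_T = (id ⊗ T)(|Ω⟩⟨Ω|)`. -/
def jamiolkowski {d : ℕ} (T : Mat d →ₗ[ℂ] Mat d) : BiMat d :=
  idTensor T (omegaProj d)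

/-- The flip operator `|k,l⟩ ↦ |l,k⟩`. -/
def flip (d : ℕ) : BiMat d :=
  Matrix.of fun p q => if p.1 = q.2 ∧ p.2 = q.1 then 1 else 0

/-- The operator `d |Ω⟩⟨Ω|`. -/
def flipHat (d : ℕ) : BiMat d := (d : ℂ) • omegaProj d

/-- The coordinates `(tr[ρ_T F], tr[ρ_T F̂])`. Both traces are real whenever `ρ_T` is Hermitian,
in particular for every channel. -/
def coords {d : ℕ} (T : Mat d →ₗ[ℂ] Mat d) : ℝ × ℝ :=
  ((jamiolkowski T * flip d).trace.re, (jamiolkowski T * flipHat d).trace.re)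

/-- The unitary channel `ρ ↦ U ρ U†`. -/
def unitaryChannel {d : ℕ} (U : Matrix.unitaryGroup (Fin d) ℂ) : Mat d →ₗ[ℂ] Mat d where
  toFun ρ := (U : Mat d) * ρ * (U : Mat d)ᴴ
  map_add' ρ τ := by rw [Matrix.mul_add, Matrix.add_mul]
  map_smul' c ρ := by rw [Matrix.mul_smul, Matrix.smul_mul, RingHom.id_apply]

/-- `T` is a mixture of unitary channels, `T(ρ) = ∑ i, p i • U i ρ (U i)†` with probabilities
`p i > 0`. -/
def IsUnitaryMixture {d : ℕ} (T : Mat d →ₗ[ℂ] Mat d) : Prop :=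
  ∃ (N : ℕ) (p : Fin N → ℝ) (U : Fin N → Matrix.unitaryGroup (Fin d) ℂ),
    (∀ i, 0 < p i) ∧ ∑ i, p i = 1 ∧ ∀ ρ, T ρ = ∑ i, (p i : ℂ) • unitaryChannel (U i) ρ

/-- `O(d)`-covariance: `T(O ρ Oᵀ) = O T(ρ) Oᵀ` for every real orthogonal `O`. -/
def IsOrthogonalCovariant {d : ℕ} (T : Mat d →ₗ[ℂ] Mat d) : Prop :=
  ∀ O ∈ Matrix.orthogonalGroup (Fin d) ℝ, ∀ ρ : Mat d,
    T (O.map Complex.ofReal * ρ * (O.map Complex.ofReal)ᵀ) =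
      O.map Complex.ofReal * T ρ * (O.map Complex.ofReal)ᵀ

/-- The mixtures of unitary channels on `d × d` matrices. -/
def unitaryMixtures (d : ℕ) : Set (Mat d →ₗ[ℂ] Mat d) := {T | IsUnitaryMixture T}

/-- The `O(d)`-covariant mixtures of unitary channels. -/
def covariantUnitaryMixtures (d : ℕ) : Set (Mat d →ₗ[ℂ] Mat d) :=
  {T | IsUnitaryMixture T ∧ IsOrthogonalCovariant T}

/-- `m(x) = [(1/2) (1 - 1/d) (1 - 2/d + x)]^(1/2) + 1/d`. -/
def maxTrace (d : ℕ) (x : ℝ) : ℝ :=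
  Real.sqrt (1 / 2 * (1 - 1 / d) * (1 - 2 / d + x)) + 1 / d

/-- The Werner-Holevo type map `ρ ↦ ((1 + δ) / d) tr[ρ] 1 - δ ρᵀ`; for `δ = 1 / (d - 1)` it is the
Werner-Holevo channel `ρ ↦ (tr[ρ] 1 - ρᵀ) / (d - 1)`. -/
def wernerHolevo (d : ℕ) (δ : ℝ) : Mat d →ₗ[ℂ] Mat d where
  toFun ρ := (((1 + δ) / d : ℝ) : ℂ) • (ρ.trace • (1 : Mat d)) - (δ : ℂ) • ρᵀ
  map_add' ρ τ := by
    rw [Matrix.trace_add, Matrix.transpose_add, add_smul, smul_add, smul_add]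
    abel
  map_smul' c ρ := by
    ext i j
    simp only [Matrix.trace_smul, Matrix.transpose_smul, RingHom.id_apply, Matrix.sub_apply,
      Matrix.smul_apply, smul_eq_mul]
    ring

end

end Birkhoff

/-!
The coordinates are linear in `T`, so those of the mixtures form the convex hull of the points
`(tr (U Ū) / d, |tr U|² / d)` of the unitary channels. In odd dimension the antisymmetric matrix
`U - Uᵀ` is singular, so the symmetric part `S` of `U` agrees with `U` on a unit vector `v` and maps
it to a unit vector `w`. Hence `S = w v† + R` with `‖R‖² = ‖S‖² - 1` in the Frobenius norm. As
`‖S‖²` is an affine function of the first coordinate, positivity of `‖R‖²` bounds that coordinate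
from below, while Cauchy-Schwarz bounds `|tr U| = |tr S|` by `1 + √((d - 1) (‖S‖² - 1))`, which
gives the curve `d m(x)²`. Direct sums of plane rotations attain the curve, and the resulting region
is convex because `m²` is concave.

No Haar measure is needed for the twirl: the mixtures with given coordinates form a compact convex
set that conjugation by real orthogonal matrices maps to itself isometrically, so its unique element
of least Frobenius norm is covariant. Covariant maps are of the form
`ρ ↦ α tr[ρ] 1 + β ρ + γ ρᵀ`, and the two coordinates together with trace preservation determine
`α`, `β` and `γ`.
-/

namespace Birkhoff

section Coordinates

variable {d : ℕ}

/-- `coords` as a real-linear map, so that it commutes with convex hulls. -/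
noncomputable def coordsLin (d : ℕ) : (Mat d →ₗ[ℂ] Mat d) →ₗ[ℝ] ℝ × ℝ where
  toFun := coords
  map_add' T S := by
    have hadd : jamiolkowski (T + S) = jamiolkowski T + jamiolkowski S := rfl
    simp only [coords, hadd, Matrix.add_mul, Matrix.trace_add, Complex.add_re, Prod.mk_add_mk]
  map_smul' c T := by
    have hsmul : jamiolkowski (c • T) = c • jamiolkowski T := rfl
    simp only [coords, hsmul, Matrix.smul_mul, Matrix.trace_smul, Complex.smul_re, Prod.smul_mk,
      RingHom.id_apply]

lemma coe_coordsLin : ⇑(coordsLin d) = coords := rfl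

lemma omegaProj_apply (p q : Fin d × Fin d) :
    omegaProj d p q = if p.1 = p.2 ∧ q.1 = q.2 then (1 / d : ℂ) else 0 := by
  have hsqrt : ((√d : ℝ) : ℂ)⁻¹ * ((√d : ℝ) : ℂ)⁻¹ = (d : ℂ)⁻¹ := by
    rw [← mul_inv, ← Complex.ofReal_mul, Real.mul_self_sqrt d.cast_nonneg, Complex.ofReal_natCast]
  by_cases hp : p.1 = p.2 <;> by_cases hq : q.1 = q.2 <;>
    simp [omegaProj, omegaVec, vecMulVec_apply, hp, hq, hsqrt]

lemma jamiolkowski_apply (T : Mat d →ₗ[ℂ] Mat d) (p q : Fin d × Fin d) :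
    jamiolkowski T p q = 1 / d * T (Matrix.single p.1 q.1 1) p.2 q.2 := by
  have hblock : (Matrix.of fun a b => omegaProj d (p.1, a) (q.1, b)) =
      (1 / d : ℂ) • Matrix.single p.1 q.1 (1 : ℂ) := by
    ext a b
    simp [omegaProj_apply, Matrix.single_apply]
  simp only [jamiolkowski, idTensor, hblock, map_smul, Matrix.of_apply, Matrix.smul_apply,
    smul_eq_mul]

lemma trace_jamiolkowski_mul_flip (T : Mat d →ₗ[ℂ] Mat d) :
    (jamiolkowski T * flip d).trace = 1 / d * ∑ i, ∑ j, T (Matrix.single i j 1) j i := by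
  simp only [Matrix.trace, Matrix.diag_apply, Matrix.mul_apply, Fintype.sum_prod_type,
    jamiolkowski_apply, flip, Matrix.of_apply, Finset.mul_sum, ite_and, mul_ite, mul_one, mul_zero]
  simp [Finset.sum_ite_irrel]

lemma trace_jamiolkowski_mul_flipHat (T : Mat d →ₗ[ℂ] Mat d) :
    (jamiolkowski T * flipHat d).trace = 1 / d * ∑ i, ∑ j, T (Matrix.single i j 1) i j := by
  rcases eq_or_ne d 0 with rfl | hd
  · simp [Matrix.trace]
  have hd' : (d : ℂ) ≠ 0 := Nat.cast_ne_zero.2 hd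
  simp only [Matrix.trace, Matrix.diag_apply, Matrix.mul_apply, Fintype.sum_prod_type,
    jamiolkowski_apply, flipHat, Matrix.smul_apply, omegaProj_apply, smul_eq_mul,
    Finset.mul_sum, ite_and, mul_ite, mul_zero]
  simp [mul_inv_cancel₀ hd', Finset.sum_ite_eq]

lemma coords_eq_sum (T : Mat d →ₗ[ℂ] Mat d) :
    coords T = (1 / d * (∑ i, ∑ j, T (Matrix.single i j 1) j i).re,
      1 / d * (∑ i, ∑ j, T (Matrix.single i j 1) i j).re) := by
  have hre (z : ℂ) : (1 / (d : ℂ) * z).re = 1 / d * z.re := by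
    rw [← Complex.re_ofReal_mul]
    push_cast
    rfl
  rw [coords, trace_jamiolkowski_mul_flip, trace_jamiolkowski_mul_flipHat, hre, hre]

lemma unitaryChannel_apply (U : Matrix.unitaryGroup (Fin d) ℂ) (ρ : Mat d) :
    unitaryChannel U ρ = (U : Mat d) * ρ * (U : Mat d)ᴴ := rfl

lemma unitaryChannel_single (U : Matrix.unitaryGroup (Fin d) ℂ) (i j a b : Fin d) :
    unitaryChannel U (Matrix.single i j 1) a b = (U : Mat d) a i * star ((U : Mat d) b j) := by
  rw [unitaryChannel_apply, Matrix.mul_assoc, Matrix.mul_apply, Finset.sum_eq_single i]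
  · rw [Matrix.single_mul_apply_same, one_mul, Matrix.conjTranspose_apply]
  · intro k _ hk
    rw [Matrix.single_mul_apply_of_ne _ _ _ _ _ hk, mul_zero]
  · simp

lemma coords_unitaryChannel (U : Matrix.unitaryGroup (Fin d) ℂ) :
    coords (unitaryChannel U) = (1 / d * ((U : Mat d) * (U : Mat d).map star).trace.re,
      1 / d * Complex.normSq (U : Mat d).trace) := by
  have hflip : ∑ i, ∑ j, (U : Mat d) j i * star ((U : Mat d) i j) =
      ((U : Mat d) * (U : Mat d).map star).trace := by
    rw [Finset.sum_comm]
    rfl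
  have hflipHat : ∑ i, ∑ j, (U : Mat d) i i * star ((U : Mat d) j j) =
      (Complex.normSq (U : Mat d).trace : ℂ) := by
    rw [← Complex.mul_conj, Matrix.trace, map_sum, Finset.sum_mul_sum]
    rfl
  simp only [coords_eq_sum, unitaryChannel_single, hflip, hflipHat, Complex.ofReal_re]

end Coordinates

section Mixtures

variable {d : ℕ}

lemma isUnitaryMixture_unitaryChannel (U : Matrix.unitaryGroup (Fin d) ℂ) :
    IsUnitaryMixture (unitaryChannel U) :=
  ⟨1, fun _ => 1, fun _ => U, by simp, by simp, by simp⟩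

lemma convex_unitaryMixtures (d : ℕ) : Convex ℝ (unitaryMixtures d) := by
  rw [convex_iff_forall_pos]
  rintro T ⟨N, p, U, hp, hp_sum, hT⟩ S ⟨M, q, V, hq, hq_sum, hS⟩ a b ha hb hab
  refine ⟨N + M, Fin.append (fun i => a * p i) (fun i => b * q i), Fin.append U V, ?_, ?_, ?_⟩
  · intro i
    refine Fin.addCases (fun i => ?_) (fun i => ?_) i
    · simpa using mul_pos ha (hp i)
    · simpa using mul_pos hb (hq i)
  · simp [Fin.sum_univ_add, ← Finset.mul_sum, hp_sum, hq_sum, hab]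
  · intro ρ
    simp [Fin.sum_univ_add, hT, hS, Finset.smul_sum, mul_smul]

lemma unitaryMixtures_eq_convexHull (d : ℕ) :
    unitaryMixtures d = convexHull ℝ (Set.range (unitaryChannel (d := d))) := by
  refine Set.Subset.antisymm ?_ (convexHull_min ?_ (convex_unitaryMixtures d))
  · rintro T ⟨N, p, U, hp, hp_sum, hT⟩
    have hT_sum : T = ∑ i, p i • unitaryChannel (U i) := by
      refine LinearMap.ext fun ρ => ?_
      simp only [hT, LinearMap.sum_apply, LinearMap.smul_apply, Complex.coe_smul]
    rw [hT_sum]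
    exact (convex_convexHull ℝ _).sum_mem (fun i _ => (hp i).le) hp_sum
      fun i _ => subset_convexHull ℝ _ ⟨U i, rfl⟩
  · rintro _ ⟨U, rfl⟩
    exact isUnitaryMixture_unitaryChannel U

lemma coords_image_unitaryMixtures (d : ℕ) :
    coords '' unitaryMixtures d =
      convexHull ℝ (Set.range fun U : Matrix.unitaryGroup (Fin d) ℂ =>
        coords (unitaryChannel U)) := by
  rw [unitaryMixtures_eq_convexHull, ← coe_coordsLin, LinearMap.image_convexHull,
    ← Set.range_comp]
  rfl

end Mixtures

section Frobenius

variable {𝕜 m n : Type*} [RCLike 𝕜] [Fintype m] [Fintype n]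

/-- The squared Frobenius norm `tr (A A†) = ∑ |A i j|²`. It is used in place of Mathlib's scoped
norm instance, which would not bring an inner product with it. -/
def frobeniusSq (A : Matrix m n 𝕜) : ℝ := RCLike.re (A * Aᴴ).trace

lemma frobeniusSq_eq_sum (A : Matrix m n 𝕜) : frobeniusSq A = ∑ i, ∑ j, ‖A i j‖ ^ 2 := by
  simp only [frobeniusSq, Matrix.trace, Matrix.diag_apply, Matrix.mul_apply,
    Matrix.conjTranspose_apply, map_sum, RCLike.star_def, RCLike.mul_conj]
  norm_cast

lemma frobeniusSq_nonneg (A : Matrix m n 𝕜) : 0 ≤ frobeniusSq A := by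
  rw [frobeniusSq_eq_sum]
  positivity

lemma frobeniusSq_eq_zero {A : Matrix m n 𝕜} : frobeniusSq A = 0 ↔ A = 0 := by
  rw [frobeniusSq_eq_sum, Finset.sum_eq_zero_iff_of_nonneg fun i _ => by positivity]
  simp only [Finset.mem_univ, true_implies,
    Finset.sum_eq_zero_iff_of_nonneg fun j (_ : j ∈ Finset.univ) => sq_nonneg ‖A _ j‖,
    sq_eq_zero_iff, norm_eq_zero, ← Matrix.ext_iff, Matrix.zero_apply]

lemma continuous_frobeniusSq : Continuous (frobeniusSq : Matrix m n 𝕜 → ℝ) := by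
  unfold frobeniusSq
  fun_prop

lemma frobeniusSq_transpose (A : Matrix m n 𝕜) : frobeniusSq Aᵀ = frobeniusSq A := by
  simp only [frobeniusSq_eq_sum, Matrix.transpose_apply]
  exact Finset.sum_comm

lemma frobeniusSq_conjTranspose (A : Matrix m n 𝕜) : frobeniusSq Aᴴ = frobeniusSq A := by
  rw [frobeniusSq, Matrix.conjTranspose_conjTranspose, Matrix.trace_mul_comm, frobeniusSq]

lemma frobeniusSq_smul (c : ℝ) (A : Matrix m n 𝕜) :
    frobeniusSq (c • A) = c ^ 2 * frobeniusSq A := by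
  simp only [frobeniusSq_eq_sum, Matrix.smul_apply, norm_smul, mul_pow, Finset.mul_sum,
    Real.norm_eq_abs, sq_abs]

lemma frobeniusSq_sub (A B : Matrix m n 𝕜) :
    frobeniusSq (A - B) = frobeniusSq A - 2 * RCLike.re (A * Bᴴ).trace + frobeniusSq B := by
  have hcross : RCLike.re (B * Aᴴ).trace = RCLike.re (A * Bᴴ).trace := by
    rw [← RCLike.conj_re, ← RCLike.star_def, ← Matrix.trace_conjTranspose,
      Matrix.conjTranspose_mul, Matrix.conjTranspose_conjTranspose]
  simp only [frobeniusSq, Matrix.conjTranspose_sub, Matrix.sub_mul, Matrix.mul_sub,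
    Matrix.trace_sub, map_sub, hcross]
  ring

lemma frobeniusSq_smul_add_smul {a b : ℝ} (hab : a + b = 1) (A B : Matrix m n 𝕜) :
    frobeniusSq (a • A + b • B) =
      a * frobeniusSq A + b * frobeniusSq B - a * b * frobeniusSq (A - B) := by
  obtain rfl : b = 1 - a := by linarith
  rw [show a • A + (1 - a) • B = a • A - (a - 1) • B by module, frobeniusSq_sub, frobeniusSq_smul,
    frobeniusSq_smul, frobeniusSq_sub A B, Matrix.conjTranspose_smul, Matrix.smul_mul,
    Matrix.mul_smul, Matrix.trace_smul, Matrix.trace_smul]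
  simp only [star_trivial, RCLike.smul_re]
  ring

lemma strictConvexOn_frobeniusSq :
    StrictConvexOn ℝ Set.univ (frobeniusSq : Matrix m n 𝕜 → ℝ) := by
  refine ⟨convex_univ, fun A _ B _ hAB a b ha hb hab => ?_⟩
  have hpos : 0 < frobeniusSq (A - B) :=
    (frobeniusSq_nonneg _).lt_of_ne' (frobeniusSq_eq_zero.not.2 (sub_ne_zero.2 hAB))
  simp only [frobeniusSq_smul_add_smul hab, smul_eq_mul]
  linarith [mul_pos (mul_pos ha hb) hpos]

lemma norm_trace_mul_sq_le (A : Matrix m n 𝕜) (B : Matrix n m 𝕜) :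
    ‖(A * B).trace‖ ^ 2 ≤ frobeniusSq A * frobeniusSq B := by
  have htri : ‖(A * B).trace‖ ≤ ∑ p : m × n, ‖A p.1 p.2‖ * ‖B p.2 p.1‖ := by
    simp only [Matrix.trace, Matrix.diag_apply, Matrix.mul_apply, Fintype.sum_prod_type,
      ← norm_mul]
    exact (norm_sum_le _ _).trans (Finset.sum_le_sum fun i _ => norm_sum_le _ _)
  calc ‖(A * B).trace‖ ^ 2
      ≤ (∑ p : m × n, ‖A p.1 p.2‖ * ‖B p.2 p.1‖) ^ 2 := by gcongr
    _ ≤ (∑ p : m × n, ‖A p.1 p.2‖ ^ 2) * ∑ p : m × n, ‖B p.2 p.1‖ ^ 2 :=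
        Finset.sum_mul_sq_le_sq_mul_sq _ _ _
    _ = frobeniusSq A * frobeniusSq B := by
        rw [← frobeniusSq_transpose B]
        simp only [frobeniusSq_eq_sum, Fintype.sum_prod_type, Matrix.transpose_apply]

variable [DecidableEq n]

lemma frobeniusSq_mul_unitary (A : Matrix m n 𝕜) {U : Matrix n n 𝕜}
    (hU : U ∈ Matrix.unitaryGroup n 𝕜) : frobeniusSq (A * U) = frobeniusSq A := by
  have hUU : U * Uᴴ = 1 := Matrix.mem_unitaryGroup_iff.1 hU
  rw [frobeniusSq, Matrix.conjTranspose_mul, Matrix.mul_assoc, ← Matrix.mul_assoc U, hUU,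
    Matrix.one_mul, frobeniusSq]

lemma frobeniusSq_unitary_mul {U : Matrix n n 𝕜} (hU : U ∈ Matrix.unitaryGroup n 𝕜)
    (A : Matrix n m 𝕜) : frobeniusSq (U * A) = frobeniusSq A := by
  have hU' : Uᴴ ∈ Matrix.unitaryGroup n 𝕜 := Unitary.star_mem hU
  rw [← frobeniusSq_conjTranspose, Matrix.conjTranspose_mul, frobeniusSq_mul_unitary _ hU',
    frobeniusSq_conjTranspose]

lemma frobeniusSq_one : frobeniusSq (1 : Matrix n n 𝕜) = Fintype.card n := by
  simp [frobeniusSq]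

lemma frobeniusSq_of_mem_unitaryGroup {U : Matrix n n 𝕜} (hU : U ∈ Matrix.unitaryGroup n 𝕜) :
    frobeniusSq U = Fintype.card n := by
  rw [← Matrix.mul_one U, frobeniusSq_unitary_mul hU, frobeniusSq_one]

end Frobenius

section OddDimension

variable {n : Type*} [Fintype n]

lemma frobeniusSq_vecMulVec_star {v w : n → ℂ} (hv : star v ⬝ᵥ v = 1) (hw : star w ⬝ᵥ w = 1) :
    frobeniusSq (vecMulVec w (star v)) = 1 := by
  rw [frobeniusSq, Matrix.conjTranspose_vecMulVec, star_star, Matrix.vecMulVec_mul_vecMulVec, hv,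
    one_smul, Matrix.trace_vecMulVec, dotProduct_comm, hw, RCLike.one_re]

lemma frobeniusSq_sub_vecMulVec {S : Matrix n n ℂ} {v w : n → ℂ} (hSv : S *ᵥ v = w)
    (hv : star v ⬝ᵥ v = 1) (hw : star w ⬝ᵥ w = 1) :
    frobeniusSq (S - vecMulVec w (star v)) = frobeniusSq S - 1 := by
  have hcross : (S * (vecMulVec w (star v))ᴴ).trace = 1 := by
    rw [Matrix.conjTranspose_vecMulVec, star_star, Matrix.mul_vecMulVec, hSv,
      Matrix.trace_vecMulVec, dotProduct_comm, hw]
  rw [frobeniusSq_sub, hcross, frobeniusSq_vecMulVec_star hv hw, RCLike.one_re]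
  ring

lemma one_le_frobeniusSq {S : Matrix n n ℂ} {v w : n → ℂ} (hSv : S *ᵥ v = w)
    (hv : star v ⬝ᵥ v = 1) (hw : star w ⬝ᵥ w = 1) : 1 ≤ frobeniusSq S := by
  have := frobeniusSq_sub_vecMulVec hSv hv hw ▸ frobeniusSq_nonneg (S - vecMulVec w (star v))
  linarith

lemma exists_real_smul_star_dotProduct_self_eq_one {v : n → ℂ} (hv : v ≠ 0) :
    ∃ r : ℝ, star (r • v) ⬝ᵥ (r • v) = 1 := by
  have hv' : WithLp.toLp 2 v ≠ 0 := (WithLp.toLp_eq_zero 2).not.2 hv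
  refine ⟨‖WithLp.toLp 2 v‖⁻¹, ?_⟩
  rw [dotProduct_comm, ← EuclideanSpace.inner_toLp_toLp, inner_self_eq_norm_sq_to_K,
    WithLp.toLp_smul, norm_smul, norm_inv, norm_norm, inv_mul_cancel₀ (norm_ne_zero_iff.2 hv')]
  simp

/-- The symmetric part `(A + Aᵀ) / 2` of a matrix. -/
noncomputable def symPart (A : Matrix n n ℂ) : Matrix n n ℂ := (1 / 2 : ℝ) • A + (1 / 2 : ℝ) • Aᵀ

lemma trace_symPart (A : Matrix n n ℂ) : (symPart A).trace = A.trace := by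
  rw [symPart, Matrix.trace_add, Matrix.trace_smul, Matrix.trace_smul, Matrix.trace_transpose,
    ← add_smul, add_halves, one_smul]

lemma symPart_mulVec {A : Matrix n n ℂ} {v : n → ℂ} (hv : A *ᵥ v = Aᵀ *ᵥ v) :
    symPart A *ᵥ v = A *ᵥ v := by
  rw [symPart, Matrix.add_mulVec, Matrix.smul_mulVec, Matrix.smul_mulVec, ← hv, ← add_smul,
    add_halves, one_smul]

/- The trace splits along `1 = v v† + (1 - v v†)`; Cauchy-Schwarz bounds both parts. -/
lemma norm_trace_le_of_mulVec_eq {S : Matrix n n ℂ} {v w : n → ℂ} (hSv : S *ᵥ v = w)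
    (hv : star v ⬝ᵥ v = 1) (hw : star w ⬝ᵥ w = 1) :
    ‖S.trace‖ ≤ 1 + √((Fintype.card n - 1) * (frobeniusSq S - 1)) := by
  classical
  set Q := vecMulVec v (star v)
  set R := S - vecMulVec w (star v)
  have hQ : frobeniusSq Q = 1 := frobeniusSq_vecMulVec_star hv hv
  have hQc : frobeniusSq (1 - Q) = Fintype.card n - 1 := by
    have := frobeniusSq_sub_vecMulVec (Matrix.one_mulVec v) hv hv
    rwa [frobeniusSq_one] at this
  have hSQ : S * Q = vecMulVec w (star v) := by rw [Matrix.mul_vecMulVec, hSv]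
  have hwQ : vecMulVec w (star v) * Q = vecMulVec w (star v) := by
    rw [Matrix.vecMulVec_mul_vecMulVec, hv, one_smul]
  have hsplit : S.trace = (vecMulVec w (star v) * Q).trace + (R * (1 - Q)).trace := by
    rw [← Matrix.trace_add, Matrix.mul_sub, Matrix.mul_one, Matrix.sub_mul, hSQ, hwQ, sub_self,
      sub_zero, add_sub_cancel]
  have hpar : ‖(vecMulVec w (star v) * Q).trace‖ ≤ 1 := by
    have := norm_trace_mul_sq_le (vecMulVec w (star v)) Q
    rw [frobeniusSq_vecMulVec_star hv hw, hQ, mul_one] at this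
    exact (sq_le_one_iff₀ (norm_nonneg _)).1 this
  have hperp : ‖(R * (1 - Q)).trace‖ ≤ √((Fintype.card n - 1) * (frobeniusSq S - 1)) := by
    refine Real.le_sqrt_of_sq_le ((norm_trace_mul_sq_le R (1 - Q)).trans_eq ?_)
    rw [hQc, frobeniusSq_sub_vecMulVec hSv hv hw, mul_comm]
  rw [hsplit]
  exact (norm_add_le _ _).trans (add_le_add hpar hperp)

lemma det_sub_transpose_eq_zero [DecidableEq n] (hodd : Odd (Fintype.card n)) (A : Matrix n n ℂ) :
    (A - Aᵀ).det = 0 := by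
  have hneg := congrArg Matrix.det (show (A - Aᵀ)ᵀ = -(A - Aᵀ) by simp)
  rw [Matrix.det_transpose, Matrix.det_neg, hodd.neg_one_pow] at hneg
  linear_combination hneg / 2

lemma exists_unit_mulVec_eq_transpose_mulVec (hodd : Odd (Fintype.card n)) (A : Matrix n n ℂ) :
    ∃ v : n → ℂ, star v ⬝ᵥ v = 1 ∧ A *ᵥ v = Aᵀ *ᵥ v := by
  classical
  obtain ⟨v, hv_ne, hv⟩ := Matrix.exists_mulVec_eq_zero_iff.2 (det_sub_transpose_eq_zero hodd A)
  rw [Matrix.sub_mulVec, sub_eq_zero] at hv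
  obtain ⟨r, hr⟩ := exists_real_smul_star_dotProduct_self_eq_one hv_ne
  exact ⟨r • v, hr, by rw [Matrix.mulVec_smul, Matrix.mulVec_smul, hv]⟩

variable [DecidableEq n] {U : Matrix n n ℂ}

lemma frobeniusSq_sub_transpose (hU : U ∈ Matrix.unitaryGroup n ℂ) :
    frobeniusSq (U - Uᵀ) = 2 * (Fintype.card n - (U * U.map star).trace.re) := by
  have hstar : Uᵀᴴ = U.map star := rfl
  rw [frobeniusSq_sub, frobeniusSq_transpose, frobeniusSq_of_mem_unitaryGroup hU, hstar,
    RCLike.re_to_complex]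
  ring

lemma frobeniusSq_symPart (hU : U ∈ Matrix.unitaryGroup n ℂ) :
    frobeniusSq (symPart U) = (Fintype.card n + (U * U.map star).trace.re) / 2 := by
  rw [symPart, frobeniusSq_smul_add_smul (by norm_num), frobeniusSq_transpose,
    frobeniusSq_of_mem_unitaryGroup hU, frobeniusSq_sub_transpose hU]
  ring

lemma re_trace_mul_map_star_le (hU : U ∈ Matrix.unitaryGroup n ℂ) :
    (U * U.map star).trace.re ≤ Fintype.card n := by
  have := frobeniusSq_sub_transpose hU ▸ frobeniusSq_nonneg (U - Uᵀ)
  linarith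

lemma exists_unit_symPart_mulVec (hodd : Odd (Fintype.card n)) (hU : U ∈ Matrix.unitaryGroup n ℂ) :
    ∃ v w : n → ℂ, symPart U *ᵥ v = w ∧ star v ⬝ᵥ v = 1 ∧ star w ⬝ᵥ w = 1 := by
  obtain ⟨v, hv, hUv⟩ := exists_unit_mulVec_eq_transpose_mulVec hodd U
  have hUU : Uᴴ * U = 1 := Matrix.mem_unitaryGroup_iff'.1 hU
  refine ⟨v, U *ᵥ v, symPart_mulVec hUv, hv, ?_⟩
  rw [Matrix.star_mulVec, Matrix.dotProduct_mulVec, Matrix.vecMul_vecMul, hUU, Matrix.vecMul_one,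
    hv]

lemma one_le_frobeniusSq_symPart (hodd : Odd (Fintype.card n))
    (hU : U ∈ Matrix.unitaryGroup n ℂ) : 1 ≤ frobeniusSq (symPart U) := by
  obtain ⟨v, w, hSv, hv, hw⟩ := exists_unit_symPart_mulVec hodd hU
  exact one_le_frobeniusSq hSv hv hw

lemma norm_trace_le_of_mem_unitaryGroup (hodd : Odd (Fintype.card n))
    (hU : U ∈ Matrix.unitaryGroup n ℂ) :
    ‖U.trace‖ ≤ 1 + √((Fintype.card n - 1) * (frobeniusSq (symPart U) - 1)) := by
  obtain ⟨v, w, hSv, hv, hw⟩ := exists_unit_symPart_mulVec hodd hU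
  exact trace_symPart U ▸ norm_trace_le_of_mulVec_eq hSv hv hw

end OddDimension

section Undergraph

/-- The points of the plane above `s` lying between the first axis and the graph of `g`. -/
def undergraph (g : ℝ → ℝ) (s : Set ℝ) : Set (ℝ × ℝ) :=
  {z | z.1 ∈ s ∧ 0 ≤ z.2 ∧ z.2 ≤ g z.1}

variable {g : ℝ → ℝ} {s : Set ℝ} {a b : ℝ}

lemma convex_undergraph (hg : ConcaveOn ℝ s g) : Convex ℝ (undergraph g s) := by
  have hupper : Convex ℝ {z : ℝ × ℝ | 0 ≤ z.2} := (convex_Ici 0).linear_preimage (.snd ℝ ℝ ℝ)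
  convert hg.convex_hypograph.inter hupper using 1
  ext z
  simp only [undergraph, Set.mem_ofPred_eq, Set.mem_inter_iff]
  tauto

lemma mem_segment_undergraph {z : ℝ × ℝ} (hz : z ∈ undergraph g s) :
    z ∈ segment ℝ (z.1, 0) (z.1, g z.1) := by
  rw [← Prod.image_mk_segment_right, segment_eq_Icc (hz.2.1.trans hz.2.2)]
  exact ⟨z.2, hz.2, rfl⟩

lemma undergraph_subset_of_convex {C : Set (ℝ × ℝ)} (hC : Convex ℝ C) (ha : (a, 0) ∈ C)
    (hb : (b, 0) ∈ C) (hgraph : ∀ x ∈ Set.Icc a b, (x, g x) ∈ C) :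
    undergraph g (Set.Icc a b) ⊆ C := by
  intro z hz
  have hbase : (z.1, 0) ∈ segment ℝ (a, (0 : ℝ)) (b, 0) := by
    rw [← Prod.image_mk_segment_left, segment_eq_Icc (hz.1.1.trans hz.1.2)]
    exact ⟨z.1, hz.1, rfl⟩
  exact hC.segment_subset (hC.segment_subset ha hb hbase) (hgraph z.1 hz.1)
    (mem_segment_undergraph hz)

lemma zero_mem_extremePoints_Ici : (0 : ℝ) ∈ (Set.Ici 0).extremePoints ℝ := by
  refine mem_extremePoints_iff_left.2 ⟨Set.self_mem_Ici, ?_⟩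
  rintro x (hx : 0 ≤ x) y (hy : 0 ≤ y) ⟨p, q, hp, hq, -, hxy⟩
  simp only [smul_eq_mul] at hxy
  have : p * x = 0 := by linarith [mul_nonneg hp.le hx, mul_nonneg hq.le hy]
  exact (mul_eq_zero.1 this).resolve_left hp.ne'

lemma mk_zero_mem_extremePoints_undergraph {x : ℝ} (hx : x ∈ s.extremePoints ℝ) (hgx : 0 ≤ g x) :
    (x, 0) ∈ (undergraph g s).extremePoints ℝ := by
  have hsub : undergraph g s ⊆ s ×ˢ Set.Ici 0 := fun z hz => ⟨hz.1, hz.2.1⟩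
  refine inter_extremePoints_subset_extremePoints_of_subset hsub ⟨⟨hx.1, le_rfl, hgx⟩, ?_⟩
  rw [extremePoints_prod]
  exact ⟨hx, zero_mem_extremePoints_Ici⟩

lemma mk_apply_mem_extremePoints_undergraph (hg : StrictConcaveOn ℝ s g) {x : ℝ} (hx : x ∈ s)
    (hgx : 0 ≤ g x) : (x, g x) ∈ (undergraph g s).extremePoints ℝ := by
  refine mem_extremePoints_iff_left.2 ⟨⟨hx, hgx, le_rfl⟩, ?_⟩
  rintro ⟨u, v⟩ ⟨hu, -, hv⟩ ⟨u', v'⟩ ⟨hu', -, hv'⟩ ⟨p, q, hp, hq, hpq, hcomb⟩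
  obtain ⟨rfl, hsnd⟩ := Prod.ext_iff.1 hcomb
  simp only [Prod.snd_add, Prod.smul_snd, Prod.fst_add, Prod.smul_fst, smul_eq_mul] at hsnd hv hv' ⊢
  have hpv := mul_le_mul_of_nonneg_left hv hp.le
  have hqv := mul_le_mul_of_nonneg_left hv' hq.le
  obtain rfl : u = u' := by
    by_contra hne
    have := hg.2 hu hu' hne hp hq hpq
    simp only [smul_eq_mul] at this
    linarith
  have hu_comb : p * u + q * u = u := by rw [← add_mul, hpq, one_mul]
  rw [hu_comb] at hsnd ⊢
  have hgu : p * g u + q * g u = g u := by rw [← add_mul, hpq, one_mul]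
  exact Prod.ext rfl (mul_left_cancel₀ hp.ne' (by linarith))

lemma extremePoints_undergraph_subset (hg : ∀ x ∈ Set.Icc a b, 0 ≤ g x) :
    (undergraph g (Set.Icc a b)).extremePoints ℝ ⊆
      {(a, 0), (b, 0)} ∪ (fun x => (x, g x)) '' Set.Icc a b := by
  rintro ⟨x, y⟩ ⟨⟨hx, hy, hyg⟩, hext⟩
  simp only at hx hy hyg
  have hab := hx.1.trans hx.2
  have hbase {t : ℝ} (ht : t ∈ Set.Icc a b) : (t, 0) ∈ undergraph g (Set.Icc a b) :=
    ⟨ht, le_rfl, hg t ht⟩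
  rcases hyg.eq_or_lt with rfl | hyg
  · exact Or.inr ⟨x, hx, rfl⟩
  rcases hy.eq_or_lt with rfl | hy
  · have hx_ext : x ∈ (Set.Icc a b).extremePoints ℝ := by
      refine mem_extremePoints_iff_left.2 ⟨hx, fun u hu u' hu' hxu => ?_⟩
      have hseg : (x, (0 : ℝ)) ∈ openSegment ℝ (u, 0) (u', 0) :=
        Prod.image_mk_openSegment_left (𝕜 := ℝ) u u' (0 : ℝ) ▸ ⟨x, hxu, rfl⟩
      exact congrArg Prod.fst (hext (hbase hu) (hbase hu') hseg)
    rw [Set.extremePoints_Icc hab] at hx_ext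
    rcases hx_ext with rfl | rfl <;> simp
  · have hseg : (x, y) ∈ openSegment ℝ (x, 0) (x, g x) :=
      Prod.image_mk_openSegment_right (𝕜 := ℝ) x 0 (g x) ▸
        ⟨y, openSegment_eq_Ioo (hy.trans hyg) ▸ ⟨hy, hyg⟩, rfl⟩
    have := hext (hbase hx) ⟨hx, hg x hx, le_rfl⟩ hseg
    exact absurd (congrArg Prod.snd this) hy.ne

lemma extremePoints_undergraph (hab : a ≤ b) (hg : StrictConcaveOn ℝ (Set.Icc a b) g)
    (hg_nonneg : ∀ x ∈ Set.Icc a b, 0 ≤ g x) :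
    (undergraph g (Set.Icc a b)).extremePoints ℝ =
      {(a, 0), (b, 0)} ∪ (fun x => (x, g x)) '' Set.Icc a b := by
  refine (extremePoints_undergraph_subset hg_nonneg).antisymm ?_
  rintro _ ((rfl | rfl) | ⟨x, hx, rfl⟩)
  · exact mk_zero_mem_extremePoints_undergraph (by simp [Set.extremePoints_Icc hab])
      (hg_nonneg _ (Set.left_mem_Icc.2 hab))
  · exact mk_zero_mem_extremePoints_undergraph (by simp [Set.extremePoints_Icc hab])
      (hg_nonneg _ (Set.right_mem_Icc.2 hab))
  · exact mk_apply_mem_extremePoints_undergraph hg hx (hg_nonneg x hx)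

end Undergraph

section Region

variable {d : ℕ}

/-- The region cut out by `-1 + 2/d ≤ ⟨F⟩ ≤ 1` and `0 ≤ ⟨F̂⟩ ≤ d m(⟨F⟩)²`; it will turn out to be
the set of coordinates of the mixtures of unitary channels. -/
noncomputable def region (d : ℕ) : Set (ℝ × ℝ) :=
  undergraph (fun x => d * maxTrace d x ^ 2) (Set.Icc (-1 + 2 / d) 1)

lemma maxTrace_eq (hd : d ≠ 0) (s : ℝ) :
    maxTrace d (2 * s / d - 1) = (1 + √((d - 1) * (s - 1))) / d := by
  have hd' : (0 : ℝ) < d := Nat.cast_pos.2 (Nat.pos_of_ne_zero hd)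
  have hradicand : 1 / 2 * (1 - 1 / (d : ℝ)) * (1 - 2 / d + (2 * s / d - 1)) =
      (d - 1) * (s - 1) / (d : ℝ) ^ 2 := by
    field_simp
    ring
  rw [maxTrace, hradicand, Real.sqrt_div' _ (by positivity), Real.sqrt_sq hd'.le]
  ring

lemma coords_unitaryChannel_mem_region (hodd : Odd d) (U : Matrix.unitaryGroup (Fin d) ℂ) :
    coords (unitaryChannel U) ∈ region d := by
  have hd : (0 : ℝ) < d := Nat.cast_pos.2 hodd.pos
  have hcard : Odd (Fintype.card (Fin d)) := by rwa [Fintype.card_fin]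
  set σ := frobeniusSq (symPart (U : Mat d))
  have hσ := one_le_frobeniusSq_symPart hcard U.2
  have hσ_le := re_trace_mul_map_star_le U.2
  have htrace := norm_trace_le_of_mem_unitaryGroup hcard U.2
  have hfst : (coords (unitaryChannel U)).1 = 2 * σ / d - 1 := by
    have hσ_eq : σ = (d + ((U : Mat d) * (U : Mat d).map star).trace.re) / 2 :=
      (frobeniusSq_symPart U.2).trans (by rw [Fintype.card_fin])
    rw [coords_unitaryChannel, hσ_eq]
    field_simp
    ring
  have hsnd : (coords (unitaryChannel U)).2 = ‖(U : Mat d).trace‖ ^ 2 / d := by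
    simp only [coords_unitaryChannel, Complex.normSq_eq_norm_sq, one_div_mul_eq_div]
  rw [Fintype.card_fin] at hσ_le htrace
  refine ⟨⟨?_, ?_⟩, ?_, ?_⟩
  · have : 2 / d ≤ 2 * σ / d := by gcongr; linarith
    linarith
  · rwa [coords_unitaryChannel, one_div_mul_eq_div, div_le_one hd]
  · rw [hsnd]
    positivity
  · calc (coords (unitaryChannel U)).2
        ≤ (1 + √((d - 1) * (σ - 1))) ^ 2 / d := by rw [hsnd]; gcongr
      _ = d * maxTrace d (2 * σ / d - 1) ^ 2 := by
          rw [maxTrace_eq hodd.pos.ne']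
          field_simp
      _ = d * maxTrace d (coords (unitaryChannel U)).1 ^ 2 := by rw [hfst]

lemma strictConcaveOn_sqrt_mul_add {c : ℝ} (hc : 0 < c) (k : ℝ) :
    StrictConcaveOn ℝ (Set.Ici (-k)) fun x => √(c * (k + x)) := by
  refine ⟨convex_Ici _, fun x hx y hy hxy p q hp hq hpq => ?_⟩
  have hnonneg {z : ℝ} (hz : -k ≤ z) : 0 ≤ c * (k + z) := mul_nonneg hc.le (by linarith)
  have hne : c * (k + x) ≠ c * (k + y) := fun h =>
    hxy (add_left_cancel (mul_left_cancel₀ hc.ne' h))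
  have hconv : p • (c * (k + x)) + q • (c * (k + y)) = c * (k + (p • x + q • y)) := by
    simp only [smul_eq_mul]
    linear_combination c * k * hpq
  have hlt := Real.strictConcaveOn_sqrt.2 (hnonneg hx) (hnonneg hy) hne hp hq hpq
  rwa [hconv] at hlt

lemma mul_maxTrace_sq (hd : 2 ≤ d) {x : ℝ} (hx : -(1 - 2 / d : ℝ) ≤ x) :
    d * maxTrace d x ^ 2 = √(2 * (1 - 1 / d) * (1 - 2 / d + x)) +
      (1 / 2 * (d - 1) * x + (1 / 2 * (d - 1) * (1 - 2 / d) + 1 / d)) := by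
  have hd' : (2 : ℝ) ≤ d := by exact_mod_cast hd
  have hd_inv : 1 / (d : ℝ) ≤ 1 := by rw [div_le_one] <;> linarith
  set A := 1 / 2 * (1 - 1 / (d : ℝ)) * (1 - 2 / d + x) with hA_def
  have hA : 0 ≤ A := mul_nonneg (by linarith) (by linarith)
  have hsqrt : √(2 * (1 - 1 / d) * (1 - 2 / d + x)) = 2 * √A := by
    rw [show 2 * (1 - 1 / (d : ℝ)) * (1 - 2 / d + x) = 2 ^ 2 * A by rw [hA_def]; ring,
      Real.sqrt_mul (by norm_num), Real.sqrt_sq (by norm_num)]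
  rw [hsqrt, maxTrace, ← hA_def, add_sq, Real.sq_sqrt hA, hA_def]
  field_simp
  ring

lemma strictConcaveOn_mul_maxTrace_sq (hd : 2 ≤ d) :
    StrictConcaveOn ℝ (Set.Icc (-1 + 2 / d : ℝ) 1) fun x => d * maxTrace d x ^ 2 := by
  have hd' : (2 : ℝ) ≤ d := by exact_mod_cast hd
  have hd_inv : 1 / (d : ℝ) < 1 := by rw [div_lt_one] <;> linarith
  have hsub : Set.Icc (-1 + 2 / d : ℝ) 1 ⊆ Set.Ici (-(1 - 2 / d)) := fun x hx => by
    simpa [add_comm] using hx.1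
  have hsqrt := (strictConcaveOn_sqrt_mul_add (c := 2 * (1 - 1 / d)) (by linarith)
    (1 - 2 / d)).subset hsub (convex_Icc _ _)
  have haffine : ConcaveOn ℝ (Set.Icc (-1 + 2 / d : ℝ) 1) fun x : ℝ =>
      1 / 2 * (d - 1) * x + (1 / 2 * (d - 1) * (1 - 2 / d) + 1 / d) :=
    ((concaveOn_id (convex_Icc _ _)).smul (by linarith)).add_const _
  exact (hsqrt.add_concaveOn haffine).congr fun x hx => (mul_maxTrace_sq hd (hsub hx)).symm

lemma convex_region (hd : 2 ≤ d) : Convex ℝ (region d) :=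
  convex_undergraph (strictConcaveOn_mul_maxTrace_sq hd).concaveOn

lemma extremePoints_region (hd : 2 ≤ d) :
    (region d).extremePoints ℝ =
      {((-1 + 2 / d : ℝ), (0 : ℝ)), ((1 : ℝ), (0 : ℝ))} ∪
        (fun x : ℝ => (x, d * maxTrace d x ^ 2)) '' Set.Icc (-1 + 2 / d : ℝ) 1 := by
  have hd' : (2 : ℝ) ≤ d := by exact_mod_cast hd
  have hd_inv : 2 / (d : ℝ) ≤ 1 := by rw [div_le_one] <;> linarith
  exact extremePoints_undergraph (by linarith) (strictConcaveOn_mul_maxTrace_sq hd)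
    fun x _ => by positivity

end Region

section ExplicitUnitaries

variable {d : ℕ}

lemma exists_coords_unitaryChannel_eq_of_card {n : Type*} [Fintype n] [DecidableEq n]
    (hn : Fintype.card n = d) {U : Matrix n n ℂ} (hU : U ∈ Matrix.unitaryGroup n ℂ) :
    ∃ V : Matrix.unitaryGroup (Fin d) ℂ, coords (unitaryChannel V) =
      (1 / d * (U * U.map star).trace.re, 1 / d * Complex.normSq U.trace) := by
  let e := Fintype.equivFinOfCardEq hn
  have hUU : U * Uᴴ = 1 := Matrix.mem_unitaryGroup_iff.1 hU
  have hV : U.submatrix e.symm e.symm ∈ Matrix.unitaryGroup (Fin d) ℂ := by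
    rw [Matrix.mem_unitaryGroup_iff, Matrix.star_eq_conjTranspose, Matrix.conjTranspose_submatrix,
      Matrix.submatrix_mul_equiv, hUU, Matrix.submatrix_one_equiv]
  have htrace (A : Matrix n n ℂ) : (A.submatrix e.symm e.symm).trace = A.trace :=
    e.symm.sum_comp fun i => A i i
  refine ⟨⟨_, hV⟩, ?_⟩
  rw [coords_unitaryChannel, ← Matrix.submatrix_map, Matrix.submatrix_mul_equiv, htrace, htrace]

variable {m ι : Type*} [Fintype m] [Fintype ι]

lemma trace_fromBlocks {R : Type*} [AddCommMonoid R] (A : Matrix m m R) (B : Matrix m ι R)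
    (C : Matrix ι m R) (D : Matrix ι ι R) : (fromBlocks A B C D).trace = A.trace + D.trace :=
  Fintype.sum_sum_type _

variable [DecidableEq m]

/-- The direct sum of `W` with one copy for each `i : m` of the plane rotation with cosine `c` and
sine `s`. -/
noncomputable def rotationSum (m : Type*) [DecidableEq m] (c s : ℝ) (W : Matrix ι ι ℂ) :
    Matrix ((m ⊕ m) ⊕ ι) ((m ⊕ m) ⊕ ι) ℂ :=
  fromBlocks (fromBlocks (c • 1) (s • 1) (-s • 1) (c • 1)) 0 0 W

lemma trace_rotationSum (c s : ℝ) (W : Matrix ι ι ℂ) :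
    (rotationSum m c s W).trace = (2 * Fintype.card m * c : ℝ) + W.trace := by
  simp only [rotationSum, trace_fromBlocks, Matrix.trace_smul, Matrix.trace_one,
    Complex.real_smul]
  push_cast
  ring

lemma trace_rotationSum_mul_map_star (c s : ℝ) (W : Matrix ι ι ℂ) :
    (rotationSum m c s W * (rotationSum m c s W).map star).trace =
      (2 * Fintype.card m * (c ^ 2 - s ^ 2) : ℝ) + (W * W.map star).trace := by
  have hmap (r : ℝ) : (r • (1 : Matrix m m ℂ)).map star = r • 1 := by
    ext i j
    by_cases hij : i = j <;> simp [hij]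
  simp only [rotationSum, fromBlocks_map, fromBlocks_multiply, trace_fromBlocks, hmap,
    Matrix.mul_smul, Matrix.mul_one, Matrix.trace_add, Matrix.trace_smul,
    Matrix.trace_one, Complex.real_smul, Matrix.map_zero _ (star_zero ℂ), Matrix.mul_zero,
    Matrix.trace_zero]
  push_cast
  ring

variable [DecidableEq ι]

lemma rotationSum_mem_unitaryGroup {c s : ℝ} (hcs : c ^ 2 + s ^ 2 = 1) {W : Matrix ι ι ℂ}
    (hW : W ∈ Matrix.unitaryGroup ι ℂ) :
    rotationSum m c s W ∈ Matrix.unitaryGroup ((m ⊕ m) ⊕ ι) ℂ := by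
  have hWW : W * Wᴴ = 1 := Matrix.mem_unitaryGroup_iff.1 hW
  have hdiag : (c * c + s * s) • (1 : Matrix m m ℂ) = 1 := by rw [← sq, ← sq, hcs, one_smul]
  have hdiag' : (s * s + c * c) • (1 : Matrix m m ℂ) = 1 := by rw [add_comm, hdiag]
  rw [Matrix.mem_unitaryGroup_iff, Matrix.star_eq_conjTranspose]
  simp [rotationSum, fromBlocks_conjTranspose, fromBlocks_multiply, hWW, smul_smul, ← add_smul,
    hdiag, hdiag', mul_comm]

lemma exists_coords_eq_rotationSum {c s : ℝ} (hcs : c ^ 2 + s ^ 2 = 1) {W : Matrix ι ι ℂ}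
    (hW : W ∈ Matrix.unitaryGroup ι ℂ) {k : ℕ} (hd : 2 * k + Fintype.card ι = d) :
    ∃ U : Matrix.unitaryGroup (Fin d) ℂ, coords (unitaryChannel U) =
      (1 / d * (2 * k * (c ^ 2 - s ^ 2) + (W * W.map star).trace.re),
        1 / d * Complex.normSq ((2 * k * c : ℝ) + W.trace)) := by
  have hcard : Fintype.card ((Fin k ⊕ Fin k) ⊕ ι) = d := by
    rw [Fintype.card_sum, Fintype.card_sum, Fintype.card_fin, ← hd, two_mul]
  obtain ⟨U, hU⟩ := exists_coords_unitaryChannel_eq_of_card hcard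
    (rotationSum_mem_unitaryGroup (m := Fin k) hcs hW)
  refine ⟨U, hU.trans ?_⟩
  rw [trace_rotationSum, trace_rotationSum_mul_map_star, Complex.add_re, Complex.ofReal_re,
    Fintype.card_fin]

lemma exists_coords_eq_of_mem_Icc {k : ℕ} (hdk : d = 2 * k + 1) {t : ℝ} (ht : t ∈ Set.Icc 0 1) :
    ∃ U : Matrix.unitaryGroup (Fin d) ℂ, coords (unitaryChannel U) =
      (2 * (1 + 2 * k * t) / d - 1, (1 + 2 * k * √t) ^ 2 / d) := by
  have hd_eq : (d : ℝ) = 2 * k + 1 := by exact_mod_cast hdk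
  have hsq : √t ^ 2 = t := Real.sq_sqrt ht.1
  have hsq' : √(1 - t) ^ 2 = 1 - t := Real.sq_sqrt (sub_nonneg.2 ht.2)
  obtain ⟨U, hU⟩ := exists_coords_eq_rotationSum (d := d) (ι := Unit) (k := k)
    (show √t ^ 2 + √(1 - t) ^ 2 = 1 by rw [hsq, hsq', add_sub_cancel]) (one_mem _) (by simp [hdk])
  refine ⟨U, hU.trans (Prod.ext ?_ ?_)⟩
  · simp only [hd_eq, hsq, hsq', Matrix.map_one star (star_zero ℂ) (star_one ℂ),
      mul_one, Matrix.trace_one, Fintype.card_unique, Nat.cast_one, Complex.one_re]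
    field_simp
    ring
  · have htrace : Complex.normSq ((2 * k * √t : ℝ) + 1) = (1 + 2 * k * √t) ^ 2 := by
      rw [← Complex.ofReal_one, ← Complex.ofReal_add, Complex.normSq_ofReal, sq, add_comm]
    simp only [Matrix.trace_one, Fintype.card_unit, Nat.cast_one, htrace,
      one_div_mul_eq_div]

lemma exists_coords_eq_curve (hd : 3 ≤ d) (hodd : Odd d) {x : ℝ}
    (hx : x ∈ Set.Icc (-1 + 2 / d : ℝ) 1) :
    ∃ U : Matrix.unitaryGroup (Fin d) ℂ,
      coords (unitaryChannel U) = (x, d * maxTrace d x ^ 2) := by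
  obtain ⟨k, hdk⟩ := hodd
  have hk : (1 : ℝ) ≤ k := by exact_mod_cast (by omega : 1 ≤ k)
  have hd_eq : (d : ℝ) = 2 * k + 1 := by exact_mod_cast hdk
  obtain ⟨t, ht, rfl⟩ : ∃ t ∈ Set.Icc (0 : ℝ) 1, x = 2 * (1 + 2 * k * t) / d - 1 := by
    rw [hd_eq] at hx
    refine ⟨((1 + x) * d / 2 - 1) / (2 * k), ⟨?_, ?_⟩, by field_simp; ring⟩
    · have := (div_le_iff₀ (by linarith)).1 (by linarith [hx.1] : 2 / (2 * k + 1 : ℝ) ≤ 1 + x)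
      rw [hd_eq]
      apply div_nonneg <;> linarith
    · rw [div_le_one (by linarith), hd_eq]
      nlinarith [hx.2]
  have hm : maxTrace d (2 * (1 + 2 * k * t) / d - 1) = (1 + 2 * k * √t) / d := by
    rw [maxTrace_eq (by omega), hd_eq,
      show (2 * (k : ℝ) + 1 - 1) * (1 + 2 * k * t - 1) = (2 * k) ^ 2 * t by ring,
      Real.sqrt_mul (by positivity), Real.sqrt_sq (by linarith)]
  obtain ⟨U, hU⟩ := exists_coords_eq_of_mem_Icc hdk ht
  refine ⟨U, hU.trans (Prod.ext rfl ?_)⟩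
  rw [hm]
  field_simp

lemma exists_coords_eq_lower_zero (hd : 3 ≤ d) (hodd : Odd d) :
    ∃ U : Matrix.unitaryGroup (Fin d) ℂ, coords (unitaryChannel U) = ((-1 + 2 / d : ℝ), 0) := by
  obtain ⟨k, hdk⟩ := hodd
  obtain ⟨k, rfl⟩ : ∃ l, k = l + 1 := ⟨k - 1, by omega⟩
  have hd_eq : (d : ℝ) = 2 * k + 3 := by rw [hdk]; push_cast; ring
  let r : ℂ := (√2 : ℝ)⁻¹
  have hr : r * r = 1 / 2 := by
    rw [← mul_inv, ← Complex.ofReal_mul, Real.mul_self_sqrt zero_le_two]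
    norm_num
  have hr_conj : starRingEnd ℂ r = r := by simp [r]
  -- `W = u uᵀ + e₃ u† - ū e₃ᵀ` for the isotropic unit vector `u = (e₁ + i e₂) / √2`.
  let W : Matrix (Fin 3) (Fin 3) ℂ :=
    !![1 / 2, Complex.I / 2, -r; Complex.I / 2, -1 / 2, Complex.I * r; r, -Complex.I * r, 0]
  have hW_conj : W.map star =
      !![1 / 2, -Complex.I / 2, -r; -Complex.I / 2, -1 / 2, -Complex.I * r;
        r, Complex.I * r, 0] := by
    ext i j
    fin_cases i <;> fin_cases j <;> simp [W, hr_conj, Complex.conj_ofNat]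
  have hW : W ∈ Matrix.unitaryGroup (Fin 3) ℂ := by
    have hstar : star W = (W.map star)ᵀ := rfl
    rw [Matrix.mem_unitaryGroup_iff, hstar, hW_conj]
    ext i j
    fin_cases i <;> fin_cases j <;>
      simp [W, Matrix.mul_apply, Fin.sum_univ_three] <;> grind [Complex.I_mul_I]
  have hW_trace : W.trace = 0 := by
    simp only [W, Matrix.trace_fin_three_of]
    ring
  have hW_star : (W * W.map star).trace = -1 := by
    rw [hW_conj, Matrix.mul_fin_three, Matrix.trace_fin_three_of]
    grind [Complex.I_mul_I]
  obtain ⟨U, hU⟩ := exists_coords_eq_rotationSum (d := d) (k := k) (c := 0) (s := 1)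
    (by norm_num) hW (by simp [hdk]; ring)
  refine ⟨U, hU.trans (Prod.ext ?_ ?_)⟩
  · simp only [hW_star, hd_eq, Complex.neg_re, Complex.one_re]
    field_simp
    ring
  · simp [hW_trace]

lemma exists_coords_eq_one_zero (hd : 2 ≤ d) :
    ∃ U : Matrix.unitaryGroup (Fin d) ℂ, coords (unitaryChannel U) = (1, 0) := by
  have hd_ne : d ≠ 0 := by omega
  obtain ⟨ζ, hζ⟩ : ∃ ζ : ℂ, IsPrimitiveRoot ζ d := ⟨_, Complex.isPrimitiveRoot_exp d hd_ne⟩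
  have hζ_star (i : ℕ) : ζ ^ i * star (ζ ^ i) = 1 := by
    rw [Complex.star_def, Complex.mul_conj, Complex.normSq_eq_norm_sq, norm_pow,
      hζ.norm'_eq_one hd_ne, one_pow, one_pow, Complex.ofReal_one]
  set D : Mat d := Matrix.diagonal fun i => ζ ^ (i : ℕ)
  have hD : D ∈ Matrix.unitaryGroup (Fin d) ℂ := by
    simp only [Matrix.mem_unitaryGroup_iff, Matrix.star_eq_conjTranspose, D,
      Matrix.diagonal_conjTranspose, Matrix.diagonal_mul_diagonal, Pi.star_apply, hζ_star,
      Matrix.diagonal_one]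
  have hD_trace : D.trace = 0 := by
    rw [Matrix.trace_diagonal, Fin.sum_univ_eq_sum_range (fun i => ζ ^ i)]
    exact hζ.geom_sum_eq_zero (by omega)
  have hD_star : (D * D.map star).trace = d := by
    simp only [D, Matrix.diagonal_map (star_zero ℂ), Matrix.diagonal_mul_diagonal,
      hζ_star, Matrix.diagonal_one, Matrix.trace_one, Fintype.card_fin]
  refine ⟨⟨D, hD⟩, ?_⟩
  simp only [coords_unitaryChannel, hD_trace, hD_star, Complex.natCast_re, map_zero, mul_zero]
  rw [one_div_mul_cancel (Nat.cast_ne_zero.2 hd_ne)]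

lemma region_eq_convexHull (hd : 3 ≤ d) (hodd : Odd d) :
    region d = convexHull ℝ (Set.range fun U : Matrix.unitaryGroup (Fin d) ℂ =>
      coords (unitaryChannel U)) := by
  refine Set.Subset.antisymm (undergraph_subset_of_convex (convex_convexHull ℝ _) ?_ ?_ ?_)
    (convexHull_min ?_ (convex_region (by omega)))
  · exact subset_convexHull ℝ _ (exists_coords_eq_lower_zero hd hodd)
  · exact subset_convexHull ℝ _ (exists_coords_eq_one_zero (by omega))
  · exact fun x hx => subset_convexHull ℝ _ (exists_coords_eq_curve hd hodd hx)
  · rintro _ ⟨U, rfl⟩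
    exact coords_unitaryChannel_mem_region hodd U

end ExplicitUnitaries

section Compactness

variable {E : Type*} [AddCommGroup E] [Module ℝ E] [TopologicalSpace E] [ContinuousAdd E]
  [ContinuousSMul ℝ E] {K : Set E}

lemma isCompact_convexJoin {C : Set E} (hK : IsCompact K) (hC : IsCompact C) :
    IsCompact (convexJoin ℝ K C) := by
  have himage : convexJoin ℝ K C =
      (fun p : ℝ × E × E => (1 - p.1) • p.2.1 + p.1 • p.2.2) '' Set.Icc 0 1 ×ˢ K ×ˢ C := by
    ext x
    simp only [mem_convexJoin, segment_eq_image, Set.mem_image, Prod.exists, Set.mem_prod]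
    tauto
  rw [himage]
  exact (isCompact_Icc.prod (hK.prod hC)).image (by fun_prop)

lemma exists_isCompact_forall_convexHull_subset (hK : IsCompact K) (m : ℕ) :
    ∃ C ⊆ convexHull ℝ K, IsCompact C ∧
      ∀ t : Finset E, ↑t ⊆ K → t.card ≤ m → convexHull ℝ (t : Set E) ⊆ C := by
  classical
  induction m with
  | zero =>
    refine ⟨∅, Set.empty_subset _, isCompact_empty, fun t _ ht => ?_⟩
    rw [Finset.card_eq_zero.1 (Nat.le_zero.1 ht), Finset.coe_empty, convexHull_empty]
  | succ m ih =>
    obtain ⟨C, hCK, hC, hsub⟩ := ih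
    have hK_sub : K ⊆ convexHull ℝ K := subset_convexHull ℝ K
    refine ⟨K ∪ convexJoin ℝ K C,
      Set.union_subset hK_sub (convexJoin_subset hK_sub hCK (convex_convexHull ℝ K)),
      hK.union (isCompact_convexJoin hK hC), fun t htK ht => ?_⟩
    rcases t.eq_empty_or_nonempty with rfl | ⟨x, hx⟩
    · simp
    have htK' : ↑(t.erase x) ⊆ K := fun y hy => htK (Finset.mem_of_mem_erase hy)
    rw [← Finset.insert_erase hx, Finset.coe_insert]
    rcases (t.erase x).eq_empty_or_nonempty with hempty | hne
    · rw [hempty]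
      simpa using Or.inl (htK hx)
    · rw [convexHull_insert hne]
      refine (convexJoin_mono (Set.singleton_subset_iff.2 (htK hx)) (hsub _ htK' ?_)).trans
        Set.subset_union_right
      rw [Finset.card_erase_of_mem hx]
      omega

lemma isCompact_convexHull [FiniteDimensional ℝ E] (hK : IsCompact K) :
    IsCompact (convexHull ℝ K) := by
  obtain ⟨C, hCK, hC, hsub⟩ :=
    exists_isCompact_forall_convexHull_subset hK (Module.finrank ℝ E + 1)
  convert hC
  refine Set.Subset.antisymm ?_ hCK
  rw [convexHull_eq_union]
  refine Set.iUnion₂_subset fun t htK => Set.iUnion_subset fun ht => hsub t htK ?_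
  rw [← Fintype.card_coe]
  exact ht.card_le_finrank_succ.trans (by gcongr; exact Submodule.finrank_le _)

lemma isCompact_unitaryGroup (n : Type*) [Fintype n] [DecidableEq n] :
    IsCompact (Matrix.unitaryGroup n ℂ : Set (Matrix n n ℂ)) := by
  have hbox : IsCompact (Set.univ.pi fun _ : n => Set.univ.pi fun _ : n =>
      Metric.closedBall (0 : ℂ) 1) :=
    isCompact_univ_pi fun _ => isCompact_univ_pi fun _ => isCompact_closedBall _ _
  have hclosed : IsClosed {A : Matrix n n ℂ | A * star A = 1} :=
    isClosed_eq (by fun_prop) continuous_const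
  have hset : (Matrix.unitaryGroup n ℂ : Set (Matrix n n ℂ)) = {A | A * star A = 1} :=
    Set.ext fun A => Matrix.mem_unitaryGroup_iff
  refine IsCompact.of_isClosed_subset (X := Matrix n n ℂ) hbox (hset ▸ hclosed) ?_
  intro A hA i _ j _
  rw [mem_closedBall_zero_iff]
  exact entry_norm_bound_of_unitary hA i j

end Compactness

section Twirling

variable {d : ℕ}

lemma unitaryChannel_one : unitaryChannel (1 : Matrix.unitaryGroup (Fin d) ℂ) = 1 := by
  refine LinearMap.ext fun ρ => ?_
  simp [unitaryChannel_apply]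

lemma unitaryChannel_mul (U V : Matrix.unitaryGroup (Fin d) ℂ) :
    unitaryChannel (U * V) = unitaryChannel U * unitaryChannel V := by
  refine LinearMap.ext fun ρ => ?_
  simp only [Module.End.mul_apply, unitaryChannel_apply, Submonoid.coe_mul,
    Matrix.conjTranspose_mul, Matrix.mul_assoc]

lemma unitaryChannel_mul_inv (V : Matrix.unitaryGroup (Fin d) ℂ) :
    unitaryChannel V * unitaryChannel V⁻¹ = 1 := by
  rw [← unitaryChannel_mul, mul_inv_cancel, unitaryChannel_one]

/-- The map `ρ ↦ V† T(V ρ V†) V`; `T` is covariant under `V` when it equals this map. -/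
def conjChannel (V : Matrix.unitaryGroup (Fin d) ℂ) (T : Mat d →ₗ[ℂ] Mat d) : Mat d →ₗ[ℂ] Mat d :=
  unitaryChannel V⁻¹ * T * unitaryChannel V

lemma IsUnitaryMixture.conjChannel {T : Mat d →ₗ[ℂ] Mat d} (hT : IsUnitaryMixture T)
    (V : Matrix.unitaryGroup (Fin d) ℂ) : IsUnitaryMixture (conjChannel V T) := by
  obtain ⟨N, p, U, hp, hp_sum, hT⟩ := hT
  refine ⟨N, p, fun i => V⁻¹ * U i * V, hp, hp_sum, fun ρ => ?_⟩
  simp only [Birkhoff.conjChannel, Module.End.mul_apply, hT, map_sum, map_smul, unitaryChannel_mul]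

lemma coords_eq_linearMap_trace (T : Mat d →ₗ[ℂ] Mat d) :
    coords T = (1 / d * (LinearMap.trace ℂ (Mat d)
      (T * (Matrix.transposeLinearEquiv (Fin d) (Fin d) ℂ ℂ).toLinearMap)).re,
      1 / d * (LinearMap.trace ℂ (Mat d) T).re) := by
  have htrace (S : Mat d →ₗ[ℂ] Mat d) :
      LinearMap.trace ℂ (Mat d) S = ∑ i, ∑ j, S (Matrix.single i j 1) i j := by
    rw [LinearMap.trace_eq_matrix_trace ℂ (Matrix.stdBasis ℂ (Fin d) (Fin d)), Matrix.trace,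
      Fintype.sum_prod_type]
    simp only [Matrix.diag_apply, LinearMap.toMatrix_apply, Matrix.stdBasis_eq_single]
    rfl
  rw [coords_eq_sum, htrace, htrace, Finset.sum_comm]
  simp [Matrix.transpose_single]

lemma conjTranspose_eq_transpose_of_map_star_eq {n R : Type*} [Star R] {A : Matrix n n R}
    (hA : A.map star = A) : Aᴴ = Aᵀ := by
  rw [Matrix.conjTranspose, Matrix.transpose_map, hA]

lemma coords_conjChannel {V : Matrix.unitaryGroup (Fin d) ℂ} (hV : (V : Mat d).map star = V)
    (T : Mat d →ₗ[ℂ] Mat d) : coords (conjChannel V T) = coords T := by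
  set τ : Mat d →ₗ[ℂ] Mat d := (Matrix.transposeLinearEquiv (Fin d) (Fin d) ℂ ℂ).toLinearMap
  have hτ : unitaryChannel V * τ = τ * unitaryChannel V := by
    refine LinearMap.ext fun ρ => ?_
    change (V : Mat d) * ρᵀ * (V : Mat d)ᴴ = ((V : Mat d) * ρ * (V : Mat d)ᴴ)ᵀ
    rw [conjTranspose_eq_transpose_of_map_star_eq hV, Matrix.transpose_mul, Matrix.transpose_mul,
      Matrix.transpose_transpose, Matrix.mul_assoc]
  have hflip : conjChannel V T * τ = unitaryChannel V⁻¹ * (T * τ) * unitaryChannel V := by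
    rw [conjChannel, mul_assoc, hτ]
    simp only [mul_assoc]
  have htrace (S : Mat d →ₗ[ℂ] Mat d) : LinearMap.trace ℂ (Mat d)
      (unitaryChannel V⁻¹ * S * unitaryChannel V) = LinearMap.trace ℂ (Mat d) S := by
    rw [LinearMap.trace_mul_comm, ← mul_assoc, unitaryChannel_mul_inv, one_mul]
  rw [coords_eq_linearMap_trace, coords_eq_linearMap_trace, hflip, conjChannel, htrace, htrace]

lemma map_ofReal_mul_transpose {O : Matrix (Fin d) (Fin d) ℝ}
    (hO : O ∈ Matrix.orthogonalGroup (Fin d) ℝ) :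
    O.map Complex.ofReal * (O.map Complex.ofReal)ᵀ = 1 :=
  (Matrix.map_mul (f := Complex.ofRealHom)).symm.trans
    ((congrArg (·.map Complex.ofReal) ((Matrix.mem_orthogonalGroup_iff (Fin d) ℝ).1 hO)).trans
      (Matrix.map_one _ Complex.ofReal_zero Complex.ofReal_one))

lemma map_ofReal_map_star (O : Matrix (Fin d) (Fin d) ℝ) :
    (O.map Complex.ofReal).map star = O.map Complex.ofReal := by
  ext i j
  simp

/-- A real orthogonal matrix as a complex unitary one. -/
noncomputable def complexify (O : Matrix.orthogonalGroup (Fin d) ℝ) :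
    Matrix.unitaryGroup (Fin d) ℂ :=
  ⟨(O : Matrix (Fin d) (Fin d) ℝ).map Complex.ofReal, by
    rw [Matrix.mem_unitaryGroup_iff, Matrix.star_eq_conjTranspose,
      conjTranspose_eq_transpose_of_map_star_eq (map_ofReal_map_star _),
      map_ofReal_mul_transpose O.2]⟩

lemma coe_complexify (O : Matrix.orthogonalGroup (Fin d) ℝ) :
    (complexify O : Mat d) = (O : Matrix (Fin d) (Fin d) ℝ).map Complex.ofReal := rfl

lemma unitaryChannel_complexify_apply (O : Matrix.orthogonalGroup (Fin d) ℝ) (ρ : Mat d) :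
    unitaryChannel (complexify O) ρ = (O : Matrix (Fin d) (Fin d) ℝ).map Complex.ofReal * ρ *
      ((O : Matrix (Fin d) (Fin d) ℝ).map Complex.ofReal)ᵀ := by
  rw [unitaryChannel_apply, coe_complexify,
    conjTranspose_eq_transpose_of_map_star_eq (map_ofReal_map_star _)]

lemma isOrthogonalCovariant_of_conjChannel_eq {T : Mat d →ₗ[ℂ] Mat d}
    (h : ∀ O, conjChannel (complexify O) T = T) : IsOrthogonalCovariant T := by
  intro O hO ρ
  have hcomm : T * unitaryChannel (complexify ⟨O, hO⟩) =
      unitaryChannel (complexify ⟨O, hO⟩) * T := by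
    conv_rhs => rw [← h ⟨O, hO⟩, conjChannel, ← mul_assoc, ← mul_assoc, unitaryChannel_mul_inv,
      one_mul]
  simpa only [Module.End.mul_apply, unitaryChannel_complexify_apply] using
    LinearMap.congr_fun hcomm ρ

lemma exists_mem_forall_eq_of_mapsTo {E : Type*} [AddCommGroup E] [Module ℝ E] [TopologicalSpace E]
    {K : Set E} (hK : IsCompact K) (hne : K.Nonempty) {φ : E → ℝ} (hφ : ContinuousOn φ K)
    (hconv : StrictConvexOn ℝ K φ) :
    ∃ x ∈ K, ∀ f : E → E, Set.MapsTo f K K → (∀ y, φ (f y) = φ y) → f x = x := by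
  obtain ⟨x, hx, hmin⟩ := hK.exists_isMinOn hne hφ
  refine ⟨x, hx, fun f hf hφf => ?_⟩
  have hmin' : IsMinOn φ K (f x) := fun y hy => (hφf x).trans_le (hmin hy)
  exact hconv.eq_of_isMinOn hmin' hmin (hf hx) hx

/-- The matrix of a linear map on `Mat d` in the basis of matrix units. It carries the topology and
the Frobenius norm in which the twirl is carried out. -/
noncomputable def transferMatrix (d : ℕ) : (Mat d →ₗ[ℂ] Mat d) ≃ₐ[ℂ] BiMat d :=
  LinearMap.toMatrixAlgEquiv (Matrix.stdBasis ℂ (Fin d) (Fin d))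

lemma transferMatrix_apply (T : Mat d →ₗ[ℂ] Mat d) (p q : Fin d × Fin d) :
    transferMatrix d T p q = T (Matrix.single q.1 q.2 1) p.1 p.2 := by
  rw [transferMatrix, LinearMap.toMatrixAlgEquiv_apply, Matrix.stdBasis_eq_single]
  rfl

lemma isLinearMap_transferMatrix (d : ℕ) : IsLinearMap ℝ (transferMatrix d) :=
  ((transferMatrix d).toLinearMap.restrictScalars ℝ).isLinear

open scoped Kronecker in
lemma transferMatrix_unitaryChannel (U : Matrix.unitaryGroup (Fin d) ℂ) :
    transferMatrix d (unitaryChannel U) = (U : Mat d) ⊗ₖ (U : Mat d).map star := by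
  ext p q
  rw [transferMatrix_apply, unitaryChannel_single]
  rfl

lemma frobeniusSq_transferMatrix_conjChannel (V : Matrix.unitaryGroup (Fin d) ℂ)
    (T : Mat d →ₗ[ℂ] Mat d) :
    frobeniusSq (transferMatrix d (conjChannel V T)) = frobeniusSq (transferMatrix d T) := by
  have hmem (U : Matrix.unitaryGroup (Fin d) ℂ) :
      transferMatrix d (unitaryChannel U) ∈ Matrix.unitaryGroup (Fin d × Fin d) ℂ := by
    rw [transferMatrix_unitaryChannel]
    exact Matrix.kronecker_mem_unitary U.2 (Matrix.map_star_mem_unitaryGroup_iff.2 U.2)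
  rw [conjChannel, map_mul, map_mul, frobeniusSq_mul_unitary _ (hmem V),
    frobeniusSq_unitary_mul (hmem V⁻¹)]

lemma isCompact_transferMatrix_image_unitaryMixtures (d : ℕ) :
    IsCompact (transferMatrix d '' unitaryMixtures d) := by
  have hunitary : CompactSpace (Matrix.unitaryGroup (Fin d) ℂ) :=
    isCompact_iff_compactSpace.1 (isCompact_unitaryGroup (Fin d))
  rw [unitaryMixtures_eq_convexHull, (isLinearMap_transferMatrix d).image_convexHull,
    ← Set.range_comp]
  refine isCompact_convexHull (isCompact_range ?_)
  simp only [Function.comp_def, transferMatrix_unitaryChannel]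
  exact continuous_matrix fun p q => by
    simp only [Matrix.kroneckerMap_apply, Matrix.map_apply]
    exact (continuous_subtype_val.matrix_elem _ _).mul (continuous_subtype_val.matrix_elem _ _).star

lemma continuous_coords_transferMatrix_symm (d : ℕ) :
    Continuous fun X => coords ((transferMatrix d).symm X) :=
  (coordsLin d ∘ₗ
    (transferMatrix d).symm.toLinearMap.restrictScalars ℝ).continuous_of_finiteDimensional

lemma coords_image_covariantUnitaryMixtures (d : ℕ) :
    coords '' covariantUnitaryMixtures d = coords '' unitaryMixtures d := by
  refine Set.Subset.antisymm (Set.image_mono fun T hT => hT.1) ?_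
  rintro _ ⟨T₀, hT₀, rfl⟩
  set S := unitaryMixtures d ∩ coords ⁻¹' {coords T₀}
  have hconvex : Convex ℝ (transferMatrix d '' S) :=
    ((convex_unitaryMixtures d).inter ((convex_singleton _).linear_preimage
      (coordsLin d))).is_linear_image (isLinearMap_transferMatrix d)
  have hcompact : IsCompact (transferMatrix d '' S) := by
    have hS : transferMatrix d '' S = transferMatrix d '' unitaryMixtures d ∩
        (fun X => coords ((transferMatrix d).symm X)) ⁻¹' {coords T₀} := by
      rw [← Set.image_inter_preimage, Set.preimage_preimage]
      simp only [AlgEquiv.symm_apply_apply]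
      rfl
    rw [hS]
    exact (isCompact_transferMatrix_image_unitaryMixtures d).inter_right
      (isClosed_singleton.preimage (continuous_coords_transferMatrix_symm d))
  obtain ⟨_, ⟨T, hT, rfl⟩, hfixed⟩ := exists_mem_forall_eq_of_mapsTo hcompact
    ⟨_, T₀, ⟨hT₀, rfl⟩, rfl⟩ continuous_frobeniusSq.continuousOn
    (strictConvexOn_frobeniusSq.subset (Set.subset_univ _) hconvex)
  refine ⟨T, ⟨hT.1, isOrthogonalCovariant_of_conjChannel_eq fun O => ?_⟩, hT.2⟩
  have hfix := hfixed (fun X => transferMatrix d (conjChannel (complexify O)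
    ((transferMatrix d).symm X))) ?_ fun X => ?_
  · simpa using hfix
  · rintro _ ⟨T', hT', rfl⟩
    simp only [AlgEquiv.symm_apply_apply]
    have hcoords := coords_conjChannel (V := complexify O) (map_ofReal_map_star _) T'
    exact ⟨_, ⟨hT'.1.conjChannel _, hcoords.trans hT'.2⟩, rfl⟩
  · rw [frobeniusSq_transferMatrix_conjChannel, AlgEquiv.apply_symm_apply]

end Twirling

section IsotropicMaps

variable {d : ℕ}

/-- The map `ρ ↦ α tr[ρ] 1 + β ρ + γ ρᵀ`, the general form of an `O(d)`-covariant linear map. -/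
noncomputable def isotropicMap (d : ℕ) (α β γ : ℂ) : Mat d →ₗ[ℂ] Mat d :=
  α • (Matrix.traceLinearMap (Fin d) ℂ ℂ).smulRight 1 + β • LinearMap.id +
    γ • (Matrix.transposeLinearEquiv (Fin d) (Fin d) ℂ ℂ).toLinearMap

lemma isotropicMap_apply (α β γ : ℂ) (ρ : Mat d) :
    isotropicMap d α β γ ρ = α • ρ.trace • (1 : Mat d) + β • ρ + γ • ρᵀ := rfl

lemma isotropicMap_single (α β γ : ℂ) (i j a b : Fin d) :
    isotropicMap d α β γ (Matrix.single i j 1) a b = (if i = j ∧ a = b then α else 0) +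
      (if i = a ∧ j = b then β else 0) + (if i = b ∧ j = a then γ else 0) := by
  by_cases hij : i = j
  · subst hij
    simp [isotropicMap_apply, Matrix.single_apply, Matrix.one_apply, and_comm]
  · simp [isotropicMap_apply, Matrix.single_apply, hij, and_comm]

lemma coords_isotropicMap (hd : d ≠ 0) (α β γ : ℂ) :
    coords (isotropicMap d α β γ) = ((α + β + d * γ).re, (α + d * β + γ).re) := by
  have hd' : (d : ℝ) ≠ 0 := Nat.cast_ne_zero.2 hd
  have hflip : ∑ i, ∑ j, isotropicMap d α β γ (Matrix.single i j 1) j i =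
      d * (α + β + d * γ) := by
    simp only [isotropicMap_single, and_self, eq_comm, Finset.sum_add_distrib, Finset.sum_ite_eq,
      Finset.mem_univ, if_true, Finset.sum_const, Finset.card_univ, Fintype.card_fin, nsmul_eq_mul]
    ring
  have hflipHat : ∑ i, ∑ j, isotropicMap d α β γ (Matrix.single i j 1) i j =
      d * (α + d * β + γ) := by
    simp only [isotropicMap_single, and_self, eq_comm, Finset.sum_add_distrib, Finset.sum_ite_eq,
      Finset.mem_univ, if_true, Finset.sum_const, Finset.card_univ, Fintype.card_fin, nsmul_eq_mul]
    ring
  have hre (z : ℂ) : 1 / (d : ℝ) * ((d : ℂ) * z).re = z.re := by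
    rw [← Complex.ofReal_natCast, Complex.re_ofReal_mul, ← mul_assoc, one_div_mul_cancel hd',
      one_mul]
  rw [coords_eq_sum, hflip, hflipHat, hre, hre]

lemma wernerHolevo_eq_isotropicMap (d : ℕ) (δ : ℝ) :
    wernerHolevo d δ = isotropicMap d ((1 + δ) / d) 0 (-δ) := by
  refine LinearMap.ext fun ρ => ?_
  change (((1 + δ) / d : ℝ) : ℂ) • (ρ.trace • (1 : Mat d)) - (δ : ℂ) • ρᵀ = _
  rw [isotropicMap_apply]
  push_cast
  module

lemma coords_wernerHolevo_lt_iff (hd : 2 ≤ d) (δ : ℝ) :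
    (coords (wernerHolevo d δ)).1 < -1 + 2 / d ↔ 1 / (d + 1) < δ := by
  have hd' : (2 : ℝ) ≤ d := by exact_mod_cast hd
  have hpos : (0 : ℝ) < (d - 1) * (d + 1) / d := by
    apply div_pos (mul_pos _ _) <;> linarith
  have hflip : (coords (wernerHolevo d δ)).1 = (1 + δ) / d - d * δ := by
    rw [wernerHolevo_eq_isotropicMap, coords_isotropicMap (by omega)]
    norm_cast
    ring
  have hgap : (-1 + 2 / d) - ((1 + δ) / d - d * δ) =
      (d - 1) * (d + 1) / d * (δ - 1 / ((d : ℝ) + 1)) := by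
    field_simp
    ring
  rw [hflip, ← sub_pos, hgap, mul_pos_iff_of_pos_left hpos, sub_pos]

end IsotropicMaps

section CovariantMaps

variable {d : ℕ} {T : Mat d →ₗ[ℂ] Mat d}

lemma IsOrthogonalCovariant.apply_single_eq_zero_of_sign (hT : IsOrthogonalCovariant T)
    {s : Fin d → ℝ} (hs : ∀ i, s i * s i = 1) {i j a b : Fin d} (hne : s i * s j ≠ s a * s b) :
    T (Matrix.single i j 1) a b = 0 := by
  have hO : Matrix.diagonal s ∈ Matrix.orthogonalGroup (Fin d) ℝ := by
    simp [Matrix.mem_orthogonalGroup_iff, hs]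
  have hconj (X : Mat d) (u v : Fin d) : ((Matrix.diagonal s).map Complex.ofReal * X *
      ((Matrix.diagonal s).map Complex.ofReal)ᵀ) u v = ((s u * s v : ℝ) : ℂ) * X u v := by
    rw [Matrix.diagonal_map Complex.ofReal_zero, Matrix.diagonal_transpose, Matrix.mul_diagonal,
      Matrix.diagonal_mul]
    push_cast
    ring
  have hsingle : (Matrix.diagonal s).map Complex.ofReal * Matrix.single i j (1 : ℂ) *
      ((Matrix.diagonal s).map Complex.ofReal)ᵀ = ((s i * s j : ℝ) : ℂ) • Matrix.single i j 1 := by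
    ext u v
    rw [hconj, Matrix.smul_apply, smul_eq_mul, Matrix.single_apply]
    split_ifs with huv
    · rw [huv.1, huv.2]
    · rw [mul_zero, mul_zero]
  have hcov := congrFun (congrFun (hT _ hO (Matrix.single i j 1)) a) b
  rw [hsingle, map_smul, hconj, Matrix.smul_apply, smul_eq_mul] at hcov
  exact (mul_eq_mul_right_iff.1 hcov).resolve_left (Complex.ofReal_injective.ne hne)

lemma IsOrthogonalCovariant.map_submatrix (hT : IsOrthogonalCovariant T) (π : Equiv.Perm (Fin d))
    (ρ : Mat d) : T (ρ.submatrix π π) = (T ρ).submatrix π π := by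
  have hO : π.permMatrix ℝ ∈ Matrix.orthogonalGroup (Fin d) ℝ := by
    rw [Matrix.mem_orthogonalGroup_iff, Matrix.transpose_permMatrix, ← Matrix.permMatrix_mul,
      inv_mul_cancel, Matrix.permMatrix_one]
  have hmap : (π.permMatrix ℝ).map Complex.ofReal = π.permMatrix ℂ :=
    PEquiv.map_toMatrix Complex.ofRealHom _
  have hconj (X : Mat d) : π.permMatrix ℂ * X * (π.permMatrix ℂ)ᵀ = X.submatrix π π := by
    rw [Matrix.transpose_permMatrix, PEquiv.toMatrix_toPEquiv_mul, PEquiv.mul_toMatrix_toPEquiv]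
    rfl
  simpa only [hmap, hconj] using hT _ hO ρ

lemma IsOrthogonalCovariant.apply_single_perm (hT : IsOrthogonalCovariant T)
    (π : Equiv.Perm (Fin d)) (i j a b : Fin d) :
    T (Matrix.single (π i) (π j) 1) (π a) (π b) = T (Matrix.single i j 1) a b := by
  rw [← Matrix.submatrix_apply (T _) π π, ← hT.map_submatrix, Matrix.submatrix_single_equiv,
    π.symm_apply_apply, π.symm_apply_apply]

lemma IsOrthogonalCovariant.apply_single_eq_of_ne (hT : IsOrthogonalCovariant T)
    {p q i j : Fin d} (hpq : p ≠ q) (hij : i ≠ j) :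
    T (Matrix.single i i 1) j j = T (Matrix.single p p 1) q q ∧
      T (Matrix.single i j 1) i j = T (Matrix.single p q 1) p q ∧
      T (Matrix.single i j 1) j i = T (Matrix.single p q 1) q p := by
  obtain ⟨π, rfl, rfl⟩ : ∃ π : Equiv.Perm (Fin d), π p = i ∧ π q = j :=
    MulAction.is_two_pretransitive_iff.1 (Equiv.Perm.isMultiplyPretransitive (Fin d) 2) hpq hij
  exact ⟨hT.apply_single_perm .., hT.apply_single_perm .., hT.apply_single_perm ..⟩

/-- The reflection in the hyperplane orthogonal to `v`. -/
noncomputable def reflectionMatrix {n : Type*} [Fintype n] [DecidableEq n] (v : n → ℝ) :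
    Matrix n n ℝ :=
  1 - (2 / (v ⬝ᵥ v)) • vecMulVec v v

lemma reflectionMatrix_mem_orthogonalGroup {n : Type*} [Fintype n] [DecidableEq n] {v : n → ℝ}
    (hv : v ≠ 0) : reflectionMatrix v ∈ Matrix.orthogonalGroup n ℝ := by
  have hvv : v ⬝ᵥ v ≠ 0 := dotProduct_self_eq_zero.not.2 hv
  have hsq : vecMulVec v v * vecMulVec v v = (v ⬝ᵥ v) • vecMulVec v v := by
    rw [vecMulVec_mul_vecMulVec, vecMulVec_smul]
  rw [Matrix.mem_orthogonalGroup_iff, reflectionMatrix, transpose_sub, transpose_one,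
    transpose_smul, transpose_vecMulVec, sub_mul, mul_sub, mul_sub]
  simp only [Matrix.one_mul, Matrix.mul_one, Matrix.smul_mul, Matrix.mul_smul, hsq]
  match_scalars
  · simp
  · field_simp
    ring

lemma IsOrthogonalCovariant.apply_single_eq_zero (hT : IsOrthogonalCovariant T) {i j a b : Fin d}
    (h₁ : ¬(i = j ∧ a = b)) (h₂ : ¬(i = a ∧ j = b)) (h₃ : ¬(i = b ∧ j = a)) :
    T (Matrix.single i j 1) a b = 0 := by
  have hflip (k : Fin d) (i : Fin d) :
      (if i = k then (-1 : ℝ) else 1) * (if i = k then -1 else 1) = 1 := by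
    split_ifs <;> norm_num
  obtain ⟨k, hk⟩ : ∃ k, (if i = k then (-1 : ℝ) else 1) * (if j = k then -1 else 1) ≠
      (if a = k then -1 else 1) * (if b = k then -1 else 1) := by
    by_contra! h
    have hi := h i
    have hj := h j
    have ha := h a
    grind
  exact hT.apply_single_eq_zero_of_sign (hflip k) hk

/-- The channel `ρ ↦ diag(ρ)`, which commutes with permutations and sign changes of the basis but
not with rotations. -/
def dephasing (d : ℕ) : Mat d →ₗ[ℂ] Mat d :=
  Matrix.diagonalLinearMap (Fin d) ℂ ℂ ∘ₗ Matrix.diagLinearMap (Fin d) ℂ ℂ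

lemma dephasing_apply (ρ : Mat d) : dephasing d ρ = Matrix.diagonal ρ.diag := rfl

lemma dephasing_single (i j a b : Fin d) :
    dephasing d (Matrix.single i j 1) a b = if i = j ∧ a = b ∧ i = a then 1 else 0 := by
  rw [dephasing_apply, Matrix.diagonal_apply, Matrix.diag_apply, Matrix.single_apply]
  grind

lemma IsOrthogonalCovariant.exists_eq_isotropicMap_add_smul_dephasing (hT : IsOrthogonalCovariant T)
    (hd : 2 ≤ d) : ∃ α β γ κ : ℂ, T = isotropicMap d α β γ + κ • dephasing d := by
  have : Nontrivial (Fin d) := Fin.nontrivial_iff_two_le.2 hd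
  obtain ⟨p, q, hpq⟩ := exists_pair_ne (Fin d)
  have hdiag (i : Fin d) : T (Matrix.single i i 1) i i = T (Matrix.single p p 1) p p := by
    simpa using hT.apply_single_perm (Equiv.swap p i) p p p p
  refine ⟨T (Matrix.single p p 1) q q, T (Matrix.single p q 1) p q, T (Matrix.single p q 1) q p,
    T (Matrix.single p p 1) p p - T (Matrix.single p p 1) q q - T (Matrix.single p q 1) p q -
      T (Matrix.single p q 1) q p, ?_⟩
  refine Matrix.ext_linearMap ℂ fun i j => LinearMap.ext_ring (Matrix.ext fun a b => ?_)
  change T (Matrix.single i j 1) a b = isotropicMap d _ _ _ (Matrix.single i j 1) a b +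
    _ * dephasing d (Matrix.single i j 1) a b
  rw [isotropicMap_single, dephasing_single]
  by_cases hij : i = j ∧ a = b
  · obtain ⟨rfl, rfl⟩ := hij
    rcases eq_or_ne i a with rfl | hia
    · simp [hdiag]
    · simp [(hT.apply_single_eq_of_ne hpq hia).1, hia]
  · by_cases hia : i = a ∧ j = b
    · obtain ⟨rfl, rfl⟩ := hia
      have hne : i ≠ j := fun h => hij ⟨h, h⟩
      simp [(hT.apply_single_eq_of_ne hpq hne).2.1, hne]
    by_cases hib : i = b ∧ j = a
    · obtain ⟨rfl, rfl⟩ := hib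
      have hne : i ≠ j := fun h => hij ⟨h, h.symm⟩
      simp [(hT.apply_single_eq_of_ne hpq hne).2.2, hne, hne.symm]
    rw [hT.apply_single_eq_zero hij hia hib]
    grind

lemma isOrthogonalCovariant_isotropicMap (α β γ : ℂ) :
    IsOrthogonalCovariant (isotropicMap d α β γ) := by
  intro O hO ρ
  have hOO := map_ofReal_mul_transpose hO
  set A := O.map Complex.ofReal
  have htrace : (A * ρ * Aᵀ).trace = ρ.trace := by
    rw [Matrix.trace_mul_comm, ← Matrix.mul_assoc, mul_eq_one_comm.1 hOO, Matrix.one_mul]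
  have htranspose : (A * ρ * Aᵀ)ᵀ = A * ρᵀ * Aᵀ := by
    rw [Matrix.transpose_mul, Matrix.transpose_mul, Matrix.transpose_transpose, Matrix.mul_assoc]
  simp only [isotropicMap_apply, htrace, htranspose, Matrix.mul_add, Matrix.add_mul,
    Matrix.mul_smul, Matrix.smul_mul, Matrix.mul_one, hOO]

lemma not_isOrthogonalCovariant_smul_dephasing (hd : 2 ≤ d) {κ : ℂ} (hκ : κ ≠ 0) :
    ¬ IsOrthogonalCovariant (κ • dephasing d) := by
  intro h
  have : Nontrivial (Fin d) := Fin.nontrivial_iff_two_le.2 hd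
  obtain ⟨p, q, hpq⟩ := exists_pair_ne (Fin d)
  set v : Fin d → ℝ := Pi.single p 1 + Pi.single q 2
  have hvp : v p = 1 := by simp [v, hpq]
  have hvq : v q = 2 := by simp [v, hpq.symm]
  have hvv : v ⬝ᵥ v = 5 := by
    simp only [v, dotProduct_add, dotProduct_single, hvp, hvq]
    norm_num
  have hv : v ≠ 0 := fun h0 => by simp [h0] at hvv
  set O : Matrix.orthogonalGroup (Fin d) ℝ :=
    ⟨reflectionMatrix v, reflectionMatrix_mem_orthogonalGroup hv⟩
  have hpp : (complexify O : Mat d) p p = 3 / 5 := by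
    norm_num [coe_complexify, O, reflectionMatrix, vecMulVec_apply, hvv, hvp]
  have hqp : (complexify O : Mat d) q p = -4 / 5 := by
    norm_num [coe_complexify, O, reflectionMatrix, vecMulVec_apply, hvv, hvp, hvq, hpq.symm]
  have hcov := congrFun (congrFun (h _ O.2 (Matrix.single p p 1)) p) q
  have hfixed : dephasing d (Matrix.single p p 1) = Matrix.single p p 1 := by
    rw [dephasing_apply, Matrix.diag_single_same, Matrix.diagonal_single]
  rw [← unitaryChannel_complexify_apply, ← unitaryChannel_complexify_apply, LinearMap.smul_apply,
    LinearMap.smul_apply, hfixed, map_smul, Matrix.smul_apply, Matrix.smul_apply,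
    unitaryChannel_single, dephasing_apply, Matrix.diagonal_apply_ne _ hpq, hpp, hqp] at hcov
  norm_num [hκ] at hcov

lemma IsOrthogonalCovariant.exists_eq_isotropicMap (hT : IsOrthogonalCovariant T) (hd : 2 ≤ d) :
    ∃ α β γ : ℂ, T = isotropicMap d α β γ := by
  obtain ⟨α, β, γ, κ, rfl⟩ := hT.exists_eq_isotropicMap_add_smul_dephasing hd
  have hκ : κ = 0 := by
    by_contra hκ
    refine not_isOrthogonalCovariant_smul_dephasing hd hκ fun O hO ρ => ?_
    simpa [isOrthogonalCovariant_isotropicMap α β γ O hO ρ, Matrix.mul_add, Matrix.add_mul]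
      using hT O hO ρ
  exact ⟨α, β, γ, by rw [hκ, zero_smul, add_zero]⟩

lemma IsUnitaryMixture.map_conjTranspose (hT : IsUnitaryMixture T) (ρ : Mat d) :
    T ρᴴ = (T ρ)ᴴ := by
  obtain ⟨N, p, U, -, -, hT⟩ := hT
  simp only [hT, unitaryChannel_apply, Matrix.conjTranspose_sum, Matrix.conjTranspose_smul,
    Matrix.conjTranspose_mul, Matrix.conjTranspose_conjTranspose, Complex.star_def,
    Complex.conj_ofReal, Matrix.mul_assoc]

lemma IsUnitaryMixture.trace_apply (hT : IsUnitaryMixture T) (ρ : Mat d) :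
    (T ρ).trace = ρ.trace := by
  obtain ⟨N, p, U, -, hp_sum, hT⟩ := hT
  have hU (i : Fin N) : (unitaryChannel (U i) ρ).trace = ρ.trace := by
    have hUU : (U i : Mat d)ᴴ * (U i : Mat d) = 1 := Matrix.mem_unitaryGroup_iff'.1 (U i).2
    rw [unitaryChannel_apply, Matrix.trace_mul_comm, ← Matrix.mul_assoc, hUU, Matrix.one_mul]
  have hp_sum' : ∑ i, (p i : ℂ) = 1 := mod_cast hp_sum
  simp only [hT, Matrix.trace_sum, Matrix.trace_smul, hU, ← Finset.sum_smul, hp_sum', one_smul]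

lemma exists_real_eq_isotropicMap (hd : 2 ≤ d) (hT : T ∈ covariantUnitaryMixtures d) :
    ∃ α β γ : ℝ, T = isotropicMap d α β γ ∧ d * α + β + γ = 1 := by
  have : Nontrivial (Fin d) := Fin.nontrivial_iff_two_le.2 hd
  obtain ⟨p, q, hpq⟩ := exists_pair_ne (Fin d)
  obtain ⟨α, β, γ, rfl⟩ := hT.2.exists_eq_isotropicMap hd
  have hentry (i j a b : Fin d) :
      isotropicMap d α β γ (Matrix.single j i 1) b a =
        star (isotropicMap d α β γ (Matrix.single i j 1) a b) := by
    rw [← Matrix.conjTranspose_apply, ← hT.1.map_conjTranspose, Matrix.conjTranspose_single,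
      star_one]
  have hα := hentry p p q q
  have hβ := hentry p q p q
  have hγ := hentry p q q p
  have htrace := hT.1.trace_apply (Matrix.single p p 1)
  rw [isotropicMap_apply, Matrix.transpose_single, Matrix.trace_add, Matrix.trace_add,
    Matrix.trace_smul, Matrix.trace_smul, Matrix.trace_smul, Matrix.trace_smul, Matrix.trace_one,
    Matrix.trace_single_eq_same, Fintype.card_fin] at htrace
  simp only [isotropicMap_single, hpq, hpq.symm, and_self, if_true, if_false, add_zero, zero_add,
    Complex.star_def] at hα hβ hγ
  have hα_re : (α.re : ℂ) = α := Complex.conj_eq_iff_re.1 hα.symm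
  have hβ_re : (β.re : ℂ) = β := Complex.conj_eq_iff_re.1 hβ.symm
  have hγ_re : (γ.re : ℂ) = γ := Complex.conj_eq_iff_re.1 hγ.symm
  refine ⟨α.re, β.re, γ.re, by rw [hα_re, hβ_re, hγ_re], Complex.ofReal_injective ?_⟩
  push_cast
  rw [hα_re, hβ_re, hγ_re]
  simp only [smul_eq_mul] at htrace
  linear_combination htrace

lemma coords_injOn_covariantUnitaryMixtures (hd : 2 ≤ d) :
    Set.InjOn coords (covariantUnitaryMixtures d) := by
  intro T hT S hS hTS
  obtain ⟨α, β, γ, rfl, htrace⟩ := exists_real_eq_isotropicMap hd hT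
  obtain ⟨α', β', γ', rfl, htrace'⟩ := exists_real_eq_isotropicMap hd hS
  have hd' : (2 : ℝ) ≤ d := by exact_mod_cast hd
  have hd_sub : (d : ℝ) - 1 ≠ 0 := by linarith
  have hd_add : (d : ℝ) + 2 ≠ 0 := by linarith
  rw [coords_isotropicMap (by omega), coords_isotropicMap (by omega), Prod.mk.injEq] at hTS
  norm_cast at hTS
  obtain ⟨hflip, hflipHat⟩ := hTS
  have hsum : α + β + γ = α' + β' + γ' :=
    mul_left_cancel₀ hd_add (by linear_combination htrace - htrace' + hflip + hflipHat)
  have hα : α = α' := mul_left_cancel₀ hd_sub (by linear_combination htrace - htrace' - hsum)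
  have hβ : β = β' := mul_left_cancel₀ hd_sub (by linear_combination hflipHat - hsum)
  have hγ : γ = γ' := mul_left_cancel₀ hd_sub (by linear_combination hflip - hsum)
  rw [hα, hβ, hγ]

end CovariantMaps

end Birkhoff

theorem mainTheorem2 (d : ℕ) (hd : 3 ≤ d) (hodd : Odd d) :
    -- the two numbers are genuine coordinates on the covariant mixtures
    Set.InjOn (Birkhoff.coords (d := d)) (Birkhoff.covariantUnitaryMixtures d) ∧
    -- the region: covariant mixtures, all mixtures, hull of the unitary channels
    Birkhoff.coords '' Birkhoff.covariantUnitaryMixtures d =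
      Birkhoff.coords '' Birkhoff.unitaryMixtures d ∧
    Birkhoff.coords '' Birkhoff.unitaryMixtures d =
      convexHull ℝ (Set.range fun U : Matrix.unitaryGroup (Fin d) ℂ =>
        Birkhoff.coords (Birkhoff.unitaryChannel U)) ∧
    -- its extreme points
    Set.extremePoints ℝ (Birkhoff.coords '' Birkhoff.covariantUnitaryMixtures d) =
      {((-1 + 2 / d : ℝ), (0 : ℝ)), ((1 : ℝ), (0 : ℝ))} ∪
        (fun x : ℝ => (x, d * Birkhoff.maxTrace d x ^ 2)) '' Set.Icc (-1 + 2 / d : ℝ) 1 ∧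
    -- maps with small flip expectation, in particular those of Werner-Holevo type
    (∀ T : Birkhoff.Mat d →ₗ[ℂ] Birkhoff.Mat d,
      (Birkhoff.coords T).1 < -1 + 2 / d → ¬ Birkhoff.IsUnitaryMixture T) ∧
    (∀ δ : ℝ, (Birkhoff.coords (Birkhoff.wernerHolevo d δ)).1 < -1 + 2 / d ↔ 1 / (d + 1) < δ) ∧
    (∀ δ : ℝ, 1 / (d + 1) < δ → ¬ Birkhoff.IsUnitaryMixture (Birkhoff.wernerHolevo d δ)) := by
  have himage := Birkhoff.coords_image_covariantUnitaryMixtures d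
  have hhull := Birkhoff.coords_image_unitaryMixtures d
  have hregion := Birkhoff.region_eq_convexHull hd hodd
  have hsmall : ∀ T : Birkhoff.Mat d →ₗ[ℂ] Birkhoff.Mat d,
      (Birkhoff.coords T).1 < -1 + 2 / d → ¬ Birkhoff.IsUnitaryMixture T := by
    intro T hlt hT
    have hmem : Birkhoff.coords T ∈ Birkhoff.region d := by
      rw [hregion, ← hhull]
      exact ⟨T, hT, rfl⟩
    exact hlt.not_ge hmem.1.1
  have hiff := Birkhoff.coords_wernerHolevo_lt_iff (show 2 ≤ d by omega)
  refine ⟨Birkhoff.coords_injOn_covariantUnitaryMixtures (by omega), himage, hhull, ?_, hsmall,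
    hiff, fun δ hδ => hsmall _ ((hiff δ).2 hδ)⟩
  rw [himage, hhull, ← hregion]
  exact Birkhoff.extremePoints_region (by omega)
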